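/- Let $\mathcal I\subset\mathbb Z\setminus\{0\}$ be finite and, for $i\in\mathcal I$, let $\lambda_i\ge 0$ be a rate function on $[0,\infty)$ with $\Lambda_i(t)=\int_0^t\lambda_i(s)\,ds<\infty$ for all $t\ge0$. A process $S$ is a non-homogeneous generalized Skellam process, $S\sim NHGSP(\lambda_i,\ i\in\mathcal I)$, if $S(t)=\sum_{i\in\mathcal I} i\,N_i(t)$ for all $t\ge 0$ almost surely, where the $N_i$ are independent non-homogeneous Poisson processes with rate functions $\lambda_i$. Let $S\sim NHGSP(\lambda_i,\ i\in\mathcal I)$, let $N(t)$ be the number of jumps of $S$ up to time $t$ and let $X_1,X_2,\dots$ be its successive jump sizes. For each $i\in\mathcal I$ let $q(\cdot\,;i)$ be a probability distribution on $\{0,1,\dots,|i|\}$, and let $Y_1,Y_2,\dots$ be random variables which, conditionally on $S$, are independent, with $Y_k$ having distribution $q(\cdot\,;X_k)$ (for the indices $k$ for which a $k$-th jump exists). Put $$S_1(t)=\sum_{k=1}^{N(t)}\mathrm{sgn}(X_k)\,Y_k,\qquad S_2(t)=\sum_{k=1}^{N(t)}\mathrm{sgn}(X_k)\,\bigl(|X_k|-Y_k\bigr),\qquad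 t\ge0.$$ Let $\mathcal I^+=\mathcal I\cap(0,\infty)$, $\mathcal I^-=\mathcal I\cap(-\infty,0)$ and $\mathcal J=\bigl\{\min(\{0\}\cup\mathcal I),\dots,\max(\{0\}\cup\mathcal I)\bigr\}\setminus\{0\}$. Then: 1. $S_1\sim NHGSP(\lambda^{(1)}_j,\ j\in\mathcal J)$ and $S_2\sim NHGSP(\lambda^{(2)}_j,\ j\in\mathcal J)$, where, for $j\in\mathcal J$, $j>0$, $$\lambda^{(1)}_j=\sum_{i\in\mathcal I^+,\ i\ge j}\lambda_i\,q(j;i),\qquad \lambda^{(2)}_j=\sum_{i\in\mathcal I^+,\ i\ge j}\lambda_i\,q(i-j;i),$$ and, for $j\in\mathcal J$, $j<0$, $$\lambda^{(1)}_j=\sum_{i\in\mathcal I^-,\ i\le j}\lambda_i\,q(|j|;i),\qquad \lambda^{(2)}_j=\sum_{i\in\mathcal I^-,\ i\le j}\lambda_i\,q(|i|-|j|;i).$$ 2. $S_1$ and $S_2$ are dependent whenever some jump is properly split with positive probability: if $t\ge0$ is such that $\Lambda_i(t)>0$ and $q(j;i)>0$ for some $i\in\mathcal I$ and some $0<j<|i|$,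 then the random variables $S_1(t)$ and $S_2(t)$ are not independent, and hence the processes $S_1$ and $S_2$ are not independent. 3. For every $t\ge0$, $S_1(t)$ and $S_2(t)$ are square integrable and $$\mathrm{Cov}\bigl(S_1(t),S_2(t)\bigr)=\sum_{i\in\mathcal I}\Lambda_i(t)\,\mathbb E\bigl[Y(|X|-Y)\,\big|\,X=i\bigr],$$ where $\mathbb E\bigl[Y(|X|-Y)\,\big|\,X=i\bigr]=\sum_{j=0}^{|i|}j\,(|i|-j)\,q(j;i)$, i.e. the conditional law of $Y$ given $X=i$ is $q(\cdot\,;i)$. -/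

import Mathlib

open MeasureTheory ProbabilityTheory
open scoped NNReal

noncomputable section

namespace Skellam

variable {Ω : Type*} [MeasurableSpace Ω]

/-- The cumulative rate `∫ₛᵗ r(u) du`. -/
def cumRate (r : ℝ → ℝ) (s t : ℝ≥0) : ℝ := ∫ u in (s : ℝ)..(t : ℝ), r u

/-- A rate function on `[0, ∞)`: nonnegative, with finite integral on every `[0, t]`.
Values at negative times are irrelevant. -/
def IsRate (r : ℝ → ℝ) : Prop :=
  (∀ u, 0 ≤ u → 0 ≤ r u) ∧ ∀ t : ℝ, 0 ≤ t → IntervalIntegrable r volume 0 t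

/-- `N` is a (non-homogeneous) Poisson process with rate function `r`: a counting process started
at `0`, with independent increments, the increment over `(s, t]` being Poisson distributed with
parameter `∫ₛᵗ r(u) du`. Almost every path is nondecreasing, so the truncated subtraction of `ℕ`
computes the true increments almost surely. -/
structure IsPoissonProcess (N : ℝ≥0 → Ω → ℕ) (r : ℝ → ℝ) (P : Measure Ω) : Prop where
  measurable : ∀ t, Measurable (N t)
  path : ∀ᵐ ω ∂P, N 0 ω = 0 ∧ Monotone (fun t => N t ω) ∧
    ∀ t, ContinuousWithinAt (fun s => N s ω) (Set.Ici t) t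
  indep : HasIndepIncrements N P
  law : ∀ s t : ℝ≥0, s ≤ t →
    HasLaw (fun ω => N t ω - N s ω) (poissonMeasure (cumRate r s t).toNNReal) P

/-- `S` is a non-homogeneous generalized Skellam process with (finite) set of jump sizes
`I ⊆ ℤ \ {0}` and rate functions `lam i`, `i ∈ I`: almost surely `S(t) = ∑ i ∈ I, i * N i t` for
all `t ≥ 0`, where the `N i` are independent Poisson processes with rate functions `lam i`. -/
structure IsNHGSP (I : Finset ℤ) (lam : ℤ → ℝ → ℝ) (S : ℝ≥0 → Ω → ℤ) (P : Measure Ω) :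
    Prop where
  zero_notMem : (0 : ℤ) ∉ I
  isRate : ∀ i ∈ I, IsRate (lam i)
  repr : ∃ N : ℤ → ℝ≥0 → Ω → ℕ,
    (∀ i ∈ I, IsPoissonProcess (N i) (lam i) P) ∧
    iIndepFun (fun (i : I) (ω : Ω) (t : ℝ≥0) => N i t ω) P ∧
    ∀ᵐ ω ∂P, ∀ t, S t ω = ∑ i ∈ I, i * (N i t ω : ℤ)

/-! ### Jumps of a path -/

/-- The jump `f(t) - f(t-)` of a path at time `t` (it is `0` at time `0`). -/
def jump (f : ℝ≥0 → ℤ) (t : ℝ≥0) : ℤ := f t - Function.leftLim f t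

/-- The number of jumps of a path in `[0, t]`. -/
def jumpCount (f : ℝ≥0 → ℤ) (t : ℝ≥0) : ℕ := {s : ℝ≥0 | s ≤ t ∧ jump f s ≠ 0}.ncard

/-- The time of the `k`-th jump of a path, `k = 1, 2, …` (only meaningful if there are at least `k`
jumps). -/
def jumpTime (f : ℝ≥0 → ℤ) (k : ℕ) : ℝ≥0 := sInf {t | k ≤ jumpCount f t}

/-- The size `X_k` of the `k`-th jump of a path, `k = 1, 2, …`. -/
def jumpSize (f : ℝ≥0 → ℤ) (k : ℕ) : ℤ := jump f (jumpTime f k)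

/-- The path of the process `S` for the outcome `ω`. -/
def path (S : ℝ≥0 → Ω → ℤ) (ω : Ω) : ℝ≥0 → ℤ := fun t => S t ω

/-! ### Splitting the jumps -/

/-- For each `i ∈ I`, `q j i` (that is, `q(j; i)`) is a probability distribution in `j` on
`{0, …, |i|}`. -/
structure IsSplitRule (I : Finset ℤ) (q : ℕ → ℤ → ℝ) : Prop where
  nonneg : ∀ i ∈ I, ∀ j, 0 ≤ q j i
  support : ∀ i ∈ I, ∀ j, i.natAbs < j → q j i = 0
  sum_eq_one : ∀ i ∈ I, ∑ j ∈ Finset.range (i.natAbs + 1), q j i = 1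

/-- The random variables `Y 1, Y 2, …` split the jumps `X_1, X_2, …` of `S` according to `q`:
given the process `S`, on the event that `S` has at least `n` jumps, the variables `Y 1, …, Y n` are
independent and `Y k` has distribution `q(· ; X_k)`. -/
structure IsSplitting (q : ℕ → ℤ → ℝ) (S : ℝ≥0 → Ω → ℤ) (Y : ℕ → Ω → ℕ) (P : Measure Ω) :
    Prop where
  measurable : ∀ k, Measurable (Y k)
  condLaw : ∀ (n : ℕ) (j : ℕ → ℕ),
    ∀ᵐ ω ∂P, (∃ t, n ≤ jumpCount (path S ω) t) →
      (P⟦{ω' | ∀ k ∈ Finset.Icc 1 n, Y k ω' = j k} |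
          MeasurableSpace.comap (path S) MeasurableSpace.pi⟧) ω =
        ∏ k ∈ Finset.Icc 1 n, q (j k) (jumpSize (path S ω) k)

/-- First component: `S₁(t) = ∑_{k ≤ N(t)} sgn(X_k) Y_k`, with `N(t)` the number of jumps of `S` up
to time `t`. -/
def splitFst (S : ℝ≥0 → Ω → ℤ) (Y : ℕ → Ω → ℕ) (t : ℝ≥0) (ω : Ω) : ℤ :=
  ∑ k ∈ Finset.Icc 1 (jumpCount (path S ω) t),
    (jumpSize (path S ω) k).sign * (Y k ω : ℤ)

/-- Second component: `S₂(t) = ∑_{k ≤ N(t)} sgn(X_k) (|X_k| - Y_k)`. -/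
def splitSnd (S : ℝ≥0 → Ω → ℤ) (Y : ℕ → Ω → ℕ) (t : ℝ≥0) (ω : Ω) : ℤ :=
  ∑ k ∈ Finset.Icc 1 (jumpCount (path S ω) t),
    (jumpSize (path S ω) k).sign * (|jumpSize (path S ω) k| - (Y k ω : ℤ))

/-- The set `{min {0, min I}, …, max {0, max I}} \ {0}`. -/
def splitSizes (I : Finset ℤ) : Finset ℤ :=
  (Finset.Icc ((insert 0 I).min' (Finset.insert_nonempty 0 I))
    ((insert 0 I).max' (Finset.insert_nonempty 0 I))).erase 0

/-- The rate of the jumps of size `j` of the first component. -/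
def splitRateFst (I : Finset ℤ) (lam : ℤ → ℝ → ℝ) (q : ℕ → ℤ → ℝ) (j : ℤ) (u : ℝ) : ℝ :=
  if 0 < j then ∑ i ∈ I with 0 < i ∧ j ≤ i, lam i u * q j.natAbs i
  else ∑ i ∈ I with i < 0 ∧ i ≤ j, lam i u * q j.natAbs i

/-- The rate of the jumps of size `j` of the second component. -/
def splitRateSnd (I : Finset ℤ) (lam : ℤ → ℝ → ℝ) (q : ℕ → ℤ → ℝ) (j : ℤ) (u : ℝ) : ℝ :=
  if 0 < j then ∑ i ∈ I with 0 < i ∧ j ≤ i, lam i u * q (i - j).natAbs i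
  else ∑ i ∈ I with i < 0 ∧ i ≤ j, lam i u * q (i.natAbs - j.natAbs) i

/-- `E[g(Y) | X = i]`, where the conditional law of `Y` given `X = i` is `q(· ; i)` on
`{0, …, |i|}`. -/
def splitMean (q : ℕ → ℤ → ℝ) (i : ℤ) (g : ℕ → ℝ) : ℝ :=
  ∑ j ∈ Finset.range (i.natAbs + 1), g j * q j i

end Skellam

end

noncomputable section

namespace Skellam

variable {Ω : Type*} [MeasurableSpace Ω]

/-! ### Joint generating functions of Poisson increments -/

/-! Give each jump of `S` the colour (i, y) formed by its size and its mark. By the marking theorem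
the counts `markCount` of the colours are independent Poisson processes with rates λ_i q(y; i). Both
components are linear in these counts, with coefficients sgn(i) y and sgn(i)(|i| - y). Grouping the
colours by the value of the coefficient and superposing shows that they are Skellam processes
(`isNHGSP_sum_marks`). Since a Poisson variable has equal mean and variance and sgn(i)² = 1, the
covariance is the sum over colours of y (|i| - y) q(y; i) Λ_i(t) (`memLp_and_covariance_sum_marks`).
No term is negative, and a properly split jump makes one positive, which excludes independence.

The marking theorem (`hasPoissonIncrements_markCount`) is proved with joint generating functions of
increments along a grid of times; on the unit circle these are characteristic functions, so they
determine independence and laws. The space is partitioned into countably many configurations: the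
numbers of jumps at the grid times and the sizes of these jumps. On one configuration only the marks
are random, and integrating them out replaces the variables z_{i,y} by their average φ_i = ∑_y q(y;
i) z_{i,y}, attached to the process N_i (`setIntegral_markCount_eq`). The Poisson exponent Λ_i (φ_i
- 1) then splits into ∑_y Λ_i q(y; i)(z_{i,y} - 1).

Two facts about paths are needed. The jumps of `S` reveal the events of the N_i only if no two
events coincide, which holds almost surely (`ae_exists_eq_of_hasLaw`). And the law of the marks is
prescribed given the σ-algebra of `S` alone, so jump counts and sizes have to be measurable
functions of the path; `AtLeastJumps` and `JumpSizeIs` describe them through countably many times.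
-/

lemma integral_pow_poissonMeasure (a : ℝ≥0) (z : ℂ) :
    ∫ n, z ^ n ∂(poissonMeasure a) = Complex.exp (a * (z - 1)) := by
  rw [integral_poissonMeasure]
  calc ∑' n : ℕ, (Real.exp (-a) * a ^ n / (n.factorial : ℝ)) • z ^ n
      = ∑' n : ℕ, (Real.exp (-a) : ℂ) * ((a * z) ^ n / (n.factorial : ℂ)) := by
        refine tsum_congr fun n => ?_
        rw [Complex.real_smul]
        push_cast
        ring
    _ = (Real.exp (-a) : ℂ) * ∑' n : ℕ, (a * z) ^ n / (n.factorial : ℂ) := tsum_mul_left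
    _ = (Real.exp (-a) : ℂ) * Complex.exp (a * z) := by
        rw [(NormedSpace.expSeries_div_hasSum_exp ((a : ℂ) * z)).tsum_eq, Complex.exp_eq_exp_ℂ]
    _ = Complex.exp (a * (z - 1)) := by
        rw [Complex.ofReal_exp, ← Complex.exp_add]
        push_cast
        ring_nf

/-- A finite family of `ℕ`-valued random variables whose joint generating function on the polydisc
is that of independent Poisson variables is such a family. -/
lemma iIndepFun_and_hasLaw_of_pgf {A : Type*} [Fintype A] {P : Measure Ω} [IsProbabilityMeasure P]
    {V : A → Ω → ℕ} (hV : ∀ a, Measurable (V a)) (μ : A → ℝ≥0)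
    (h : ∀ z : A → ℂ, (∀ a, ‖z a‖ ≤ 1) →
      ∫ ω, ∏ a, z a ^ V a ω ∂P = ∏ a, Complex.exp (μ a * (z a - 1))) :
    iIndepFun V P ∧ ∀ a, HasLaw (V a) (poissonMeasure (μ a)) P := by
  classical
  have hVr : ∀ a, Measurable (fun ω => (V a ω : ℝ)) := fun a =>
    (Measurable.of_discrete (f := fun n : ℕ => (n : ℝ))).comp (hV a)
  have hone : ∀ x : ℝ, ‖Complex.exp (x * Complex.I)‖ ≤ 1 := fun x =>
    (Complex.norm_exp_ofReal_mul_I x).le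
  have hlawr : ∀ a, P.map (fun ω => (V a ω : ℝ)) =
      (poissonMeasure (μ a)).map (Nat.cast : ℕ → ℝ) := by
    intro a
    have : IsProbabilityMeasure (P.map (fun ω => (V a ω : ℝ))) :=
      Measure.isProbabilityMeasure_map (hVr a).aemeasurable
    refine Measure.ext_of_charFun (funext fun t => ?_)
    rw [charFun_map_cast_poissonMeasure, charFun_apply,
      integral_map (hVr a).aemeasurable (by fun_prop)]
    -- Setting all variables but one to `1` gives the marginal; a variable on the unit circle gives
    -- its characteristic function.
    have := h (fun b => if b = a then Complex.exp (t * Complex.I) else 1) (fun b => by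
      split_ifs
      · exact hone t
      · simp)
    rw [Fintype.prod_eq_single a (fun b hb => by simp [hb])] at this
    rw [if_pos rfl] at this
    rw [← this]
    refine integral_congr_ae (Filter.Eventually.of_forall fun ω => ?_)
    dsimp only
    rw [Fintype.prod_eq_single a (fun b hb => by simp [hb]), if_pos rfl, ← Complex.exp_nat_mul,
      Real.inner_apply]
    push_cast
    ring_nf
  have hind : iIndepFun (fun a ω => (V a ω : ℝ)) P := by
    rw [iIndepFun_iff_charFun_pi (fun a => (hVr a).aemeasurable)]
    intro t
    rw [charFun_apply, integral_map (by fun_prop) (by fun_prop)]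
    simp_rw [hlawr, charFun_map_cast_poissonMeasure]
    rw [← h (fun a => Complex.exp (t a * Complex.I)) (fun a => hone _)]
    refine integral_congr_ae (Filter.Eventually.of_forall fun ω => ?_)
    dsimp only
    simp_rw [← Complex.exp_nat_mul]
    rw [← Complex.exp_sum, PiLp.inner_apply]
    simp only [Real.inner_apply]
    push_cast
    rw [Finset.sum_mul]
    congr 1
    exact Finset.sum_congr rfl fun a _ => by ring
  refine ⟨?_, fun a => ⟨(hV a).aemeasurable, ?_⟩⟩
  -- The floor undoes the cast to `ℝ`, so independence returns to the `ℕ`-valued variables.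
  · have := hind.comp (fun _ x => ⌊x⌋₊) (fun _ => Nat.measurable_floor)
    convert! this using 2 with a
    ext ω
    simp
  · apply (MeasurableEmbedding.natCast (α := ℝ)).map_injective
    rw [Measure.map_map .of_discrete (hV a)]
    exact hlawr a

lemma IsRate.intervalIntegrable {r : ℝ → ℝ} (hr : IsRate r) (s t : ℝ≥0) :
    IntervalIntegrable r volume (s : ℝ) t :=
  (hr.2 s s.2).symm.trans (hr.2 t t.2)

lemma IsRate.cumRate_nonneg {r : ℝ → ℝ} (hr : IsRate r) {s t : ℝ≥0} (h : s ≤ t) :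
    0 ≤ cumRate r s t :=
  intervalIntegral.integral_nonneg (by exact_mod_cast h) fun u hu => hr.1 u (s.2.trans hu.1)

/-- The increments over disjoint intervals of all the processes `M c` are jointly independent and
Poisson distributed, expressed through their joint generating function. -/
def HasPoissonIncrements {C : Type*} [Fintype C] (M : C → ℝ≥0 → Ω → ℕ) (r : C → ℝ → ℝ)
    (P : Measure Ω) : Prop :=
  ∀ t : ℕ → ℝ≥0, Monotone t → ∀ (m : ℕ) (z : C → ℕ → ℂ), (∀ c l, ‖z c l‖ ≤ 1) →
    ∫ ω, ∏ c, ∏ l ∈ Finset.range m, z c l ^ (M c (t (l + 1)) ω - M c (t l) ω) ∂P =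
      ∏ c, ∏ l ∈ Finset.range m, Complex.exp (cumRate (r c) (t l) (t (l + 1)) * (z c l - 1))

lemma hasPoissonIncrements_of_iIndepFun {C : Type*} [Fintype C] {P : Measure Ω}
    [IsProbabilityMeasure P] {N : C → ℝ≥0 → Ω → ℕ} {r : C → ℝ → ℝ}
    (hr : ∀ c, IsRate (r c)) (hN : ∀ c, IsPoissonProcess (N c) (r c) P)
    (hind : iIndepFun (fun c ω t => N c t ω) P) : HasPoissonIncrements N r P := by
  intro t ht m z _
  rw [hind.integral_fun_prod_comp
    (f := fun c x => ∏ l ∈ Finset.range m, z c l ^ (x (t (l + 1)) - x (t l)))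
    (fun c => (measurable_pi_lambda _ fun s => (hN c).measurable s).aemeasurable)
    (fun c => by
      refine (Finset.measurable_prod _ fun l _ => ?_).aestronglyMeasurable
      have h1 : Measurable (fun x : ℝ≥0 → ℕ => x (t (l + 1)) - x (t l)) :=
        (measurable_pi_apply _).sub (measurable_pi_apply _)
      exact (Measurable.of_discrete (f := fun n : ℕ => z c l ^ n)).comp h1)]
  refine Finset.prod_congr rfl fun c _ => ?_
  simp_rw [Finset.prod_range]
  have h1 : iIndepFun (fun (l : Fin m) ω => N c (t (l + 1)) ω - N c (t l) ω) P :=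
    ((hN c).indep.nat ht).precomp Fin.val_injective
  rw [h1.integral_fun_prod_comp (f := fun (l : Fin m) (n : ℕ) => z c l ^ n)
    (fun l => (((hN c).measurable _).sub ((hN c).measurable _)).aemeasurable)
    (fun l => Measurable.of_discrete.aestronglyMeasurable)]
  refine Finset.prod_congr rfl fun l _ => ?_
  have hle : t l ≤ t (l + 1) := ht (Nat.le_succ _)
  have h2 := ((hN c).law _ _ hle).integral_comp
    (f := fun n : ℕ => z c l ^ n) Measurable.of_discrete.aestronglyMeasurable
  refine h2.trans ?_
  rw [integral_pow_poissonMeasure, Real.coe_toNNReal _ ((hr c).cumRate_nonneg hle)]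

section

variable {C : Type*} [Fintype C] {P : Measure Ω} [IsProbabilityMeasure P]
  {M : C → ℝ≥0 → Ω → ℕ} {r : C → ℝ → ℝ}

/-- The pairs (process, cell) form a sigma type so that `iIndepFun_blocks` can later regroup the
increments by process. -/
lemma HasPoissonIncrements.iIndepFun_and_hasLaw (h : HasPoissonIncrements M r P)
    (hr : ∀ c, IsRate (r c)) (hM : ∀ c t, Measurable (M c t)) {t : ℕ → ℝ≥0} (ht : Monotone t)
    (m : ℕ) :
    iIndepFun (fun (p : (_ : C) × Fin m) ω => M p.1 (t (p.2 + 1)) ω - M p.1 (t p.2) ω) P ∧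
      ∀ p : (_ : C) × Fin m, HasLaw (fun ω => M p.1 (t (p.2 + 1)) ω - M p.1 (t p.2) ω)
        (poissonMeasure (cumRate (r p.1) (t p.2) (t (p.2 + 1))).toNNReal) P := by
  refine iIndepFun_and_hasLaw_of_pgf (A := (_ : C) × Fin m)
    (V := fun p ω => M p.1 (t (p.2 + 1)) ω - M p.1 (t p.2) ω)
    (fun p => (hM _ _).sub (hM _ _))
    (fun p => (cumRate (r p.1) (t p.2) (t (p.2 + 1))).toNNReal) fun z hz => ?_
  have := h t ht m (fun c l => if hl : l < m then z ⟨c, ⟨l, hl⟩⟩ else 1) (fun c l => by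
    split_ifs
    · exact hz _
    · simp)
  simp_rw [Finset.prod_range] at this
  simp only [Fin.is_lt, dite_true, Fin.eta] at this
  simp_rw [Fintype.prod_sigma]
  rw [this]
  refine Finset.prod_congr rfl fun c _ => Finset.prod_congr rfl fun l _ => ?_
  rw [Real.coe_toNNReal _ ((hr c).cumRate_nonneg (ht (Nat.le_succ _)))]

end

/-- Blocks of a mutually independent family are mutually independent. -/
lemma iIndepFun_blocks {ι : Type*} {κ : ι → Type*} {𝓧 : (i : ι) → κ i → Type*}
    {m𝓧 : ∀ i j, MeasurableSpace (𝓧 i j)} {P : Measure Ω}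
    {X : (i : ι) → (j : κ i) → Ω → 𝓧 i j} (mX : ∀ i j, Measurable (X i j))
    (h : iIndepFun (fun (p : (i : ι) × (κ i)) ω => X p.1 p.2 ω) P) :
    iIndepFun (fun i ω j => X i j ω) P := by
  have := h.isProbabilityMeasure
  have : ∀ i j, IsProbabilityMeasure (P.map (X i j)) :=
    fun i j => Measure.isProbabilityMeasure_map (mX i j).aemeasurable
  have : ∀ i, IsProbabilityMeasure (P.map (fun ω => (X i · ω))) :=
    fun i => Measure.isProbabilityMeasure_map (Measurable.aemeasurable (by fun_prop))
  -- Independence says that the joint law is a product measure; currying carries the product over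
  -- pairs to the product over `i` of the products over `j`.
  have hcomp : (MeasurableEquiv.piCurry 𝓧) ∘ (fun ω p => X p.1 p.2 ω) = fun ω i j => X i j ω := by
    ext; simp [Sigma.curry]
  have h2 : ∀ i, iIndepFun (X i) P := fun i =>
    h.precomp (g := fun j => (⟨i, j⟩ : (i : ι) × κ i)) (fun a b hab => by simpa using hab)
  rw [iIndepFun_iff_map_fun_eq_infinitePi_map (by fun_prop)] at h ⊢
  rw [← hcomp, ← Measure.map_map (by fun_prop) (by fun_prop), h,
    Measure.infinitePi_map_piCurry (fun i j => P.map (X i j))]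
  congrm Measure.infinitePi fun i => ?_
  rw [(iIndepFun_iff_map_fun_eq_infinitePi_map (by fun_prop)).1 (h2 i)]

/-- The path properties required of a counting process. -/
structure IsCounting (N : ℝ≥0 → Ω → ℕ) (P : Measure Ω) : Prop where
  measurable : ∀ t, Measurable (N t)
  path : ∀ᵐ ω ∂P, N 0 ω = 0 ∧ Monotone (fun t => N t ω) ∧
    ∀ t, ContinuousWithinAt (fun s => N s ω) (Set.Ici t) t

/-- The sequence stays at the largest time once the set is exhausted, hence is monotone on all of
`ℕ`. Starting at `0` makes every value of a counting process a sum of increments. -/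
lemma exists_monotone_enum (J : Finset ℝ≥0) :
    ∃ (t : ℕ → ℝ≥0) (m : ℕ), Monotone t ∧ t 0 = 0 ∧ ∀ s ∈ J, ∃ k ≤ m, t k = s := by
  set K := insert 0 J with hK
  have hpos : 0 < K.card := Finset.card_pos.2 ⟨0, by simp [hK]⟩
  refine ⟨fun k => K.orderEmbOfFin rfl ⟨min k (K.card - 1), by omega⟩, K.card, ?_, ?_, ?_⟩
  · intro a b hab
    refine (K.orderEmbOfFin rfl).monotone ?_
    simp only [Fin.mk_le_mk]
    omega
  · simp only [zero_le, inf_of_le_left]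
    rw [Finset.orderEmbOfFin_zero rfl hpos]
    exact le_antisymm (Finset.min'_le _ _ (by simp [hK])) bot_le
  · intro s hs
    have : s ∈ Set.range (K.orderEmbOfFin rfl) := by
      rw [Finset.range_orderEmbOfFin]
      simp [hK, hs]
    obtain ⟨k, rfl⟩ := this
    refine ⟨k, k.2.le, congrArg _ (Fin.ext ?_)⟩
    exact min_eq_left (Nat.le_sub_one_of_lt k.2)

section

variable {C : Type*} [Fintype C] {P : Measure Ω} [IsProbabilityMeasure P]
  {M : C → ℝ≥0 → Ω → ℕ} {r : C → ℝ → ℝ}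

lemma HasPoissonIncrements.hasLaw (h : HasPoissonIncrements M r P)
    (hr : ∀ c, IsRate (r c)) (hM : ∀ c t, Measurable (M c t)) (c : C) {s t : ℝ≥0} (hst : s ≤ t) :
    HasLaw (fun ω => M c t ω - M c s ω) (poissonMeasure (cumRate (r c) s t).toNNReal) P := by
  -- The grid s, t, t, … has the single relevant cell (s, t].
  have hmono : Monotone (fun n : ℕ => if n = 0 then s else t) := by
    intro a b hab
    dsimp only
    split_ifs with h1 h2
    · exact le_rfl
    · exact hst
    · omega
    · exact le_rfl
  have := (h.iIndepFun_and_hasLaw hr hM hmono 1).2 ⟨c, 0⟩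
  simpa using this

lemma HasPoissonIncrements.isPoissonProcess (h : HasPoissonIncrements M r P)
    (hr : ∀ c, IsRate (r c)) (hM : ∀ c, IsCounting (M c) P) (c : C) :
    IsPoissonProcess (M c) (r c) P where
  measurable := (hM c).measurable
  path := (hM c).path
  indep := by
    refine HasIndepIncrements.of_nat fun t ht _ => iIndepFun_iff_finset.2 fun s => ?_
    have h1 := (h.iIndepFun_and_hasLaw hr (fun c => (hM c).measurable) ht (s.sup id + 1)).1
    refine h1.precomp (g := fun x : s =>
      (⟨c, ⟨x, Nat.lt_succ_of_le (Finset.le_sup (f := id) x.2)⟩⟩ : (_ : C) × Fin _)) ?_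
    intro a b hab
    exact Subtype.ext (congrArg (fun p : (_ : C) × Fin (s.sup id + 1) => (p.2 : ℕ)) hab)
  law := fun s t hst => h.hasLaw hr (fun c => (hM c).measurable) c hst

/-- Finitely many times of all the processes fit on one grid. The values at these times are partial
sums of the increments, which are independent in blocks, one block for each process. -/
lemma HasPoissonIncrements.iIndepFun (h : HasPoissonIncrements M r P)
    (hr : ∀ c, IsRate (r c)) (hM : ∀ c, IsCounting (M c) P) :
    iIndepFun (fun c ω t => M c t ω) P := by
  refine iIndepFun.iIndepFun_process (X := M) (fun c t => (hM c).measurable t) fun I J => ?_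
  obtain ⟨t, m, ht, h0, hJ⟩ := exists_monotone_enum (Finset.univ.biUnion J)
  have h1 := (h.iIndepFun_and_hasLaw hr (fun c => (hM c).measurable) ht m).1
  have h2 := iIndepFun_blocks (X := fun (c : C) (l : Fin m) ω => M c (t (l + 1)) ω - M c (t l) ω)
    (fun c l => ((hM c).measurable _).sub ((hM c).measurable _)) h1
  have h3 := h2.precomp (g := fun i : I => (i : C)) Subtype.val_injective
  choose k hkm hk using fun (i : I) (j : J i) =>
    hJ j (Finset.mem_biUnion.2 ⟨i, Finset.mem_univ _, j.2⟩)
  have h4 := h3.comp (fun (i : I) x (j : J i) =>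
      ∑ l : Fin m, if (l : ℕ) < k i j then x l else 0) (fun i => by
    refine measurable_pi_lambda _ fun j => Finset.measurable_sum _ fun l _ => ?_
    split_ifs <;> fun_prop)
  refine iIndepFun.process_congr h4 fun i j => ?_
  filter_upwards [(hM i).path] with ω hω
  simp only [Function.comp]
  rw [← hk i j]
  have : ∀ n ≤ m, (∑ l : Fin m, if (l : ℕ) < n then M i (t (l + 1)) ω - M i (t l) ω else 0) =
      M i (t n) ω := by
    intro n hn
    rw [Fin.sum_univ_eq_sum_range
      (fun l => if l < n then M i (t (l + 1)) ω - M i (t l) ω else 0), ← Finset.sum_filter]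
    have hf : (Finset.range m).filter (· < n) = Finset.range n := by
      ext; simp only [Finset.mem_filter, Finset.mem_range]; omega
    rw [hf, Finset.sum_range_tsub (f := fun l => M i (t l) ω) (fun a b hab => hω.2.1 (ht hab)),
      h0, hω.1, tsub_zero]
  exact this _ (hkm i j)

end

/-- Superposition: sums of the processes over disjoint groups of indices. -/
lemma HasPoissonIncrements.superpose {C D : Type*} [Fintype C] [Fintype D] [DecidableEq D]
    {P : Measure Ω} [IsProbabilityMeasure P] {M : C → ℝ≥0 → Ω → ℕ} {r : C → ℝ → ℝ}
    (h : HasPoissonIncrements M r P) (hr : ∀ c, IsRate (r c)) (hM : ∀ c, IsCounting (M c) P)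
    (φ : C → Option D) {N : D → ℝ≥0 → Ω → ℕ} {r' : D → ℝ → ℝ}
    (hN : ∀ d t ω, N d t ω = ∑ c with φ c = some d, M c t ω)
    (hr' : ∀ d u, r' d u = ∑ c with φ c = some d, r c u) :
    HasPoissonIncrements N r' P := by
  intro t ht m z hz
  -- Indices sent to `none` get the variable `1`, so they disappear from the generating function.
  have key := h t ht m (fun c l => (φ c).elim 1 (fun d => z d l)) (fun c l => by
    cases hc : φ c with
    | none => simp
    | some d => simpa using hz d l)
  have split : ∀ F : C → ℂ, (∀ c, φ c = none → F c = 1) →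
      ∏ c, F c = ∏ d, ∏ c with φ c = some d, F c := by
    intro F hF
    rw [← Finset.prod_fiberwise (s := Finset.univ) (g := φ) (f := F), Fintype.prod_option,
      Finset.prod_eq_one (s := Finset.univ.filter fun c => φ c = none), one_mul]
    intro c hc
    exact hF c (by simpa using hc)
  have hpath : ∀ᵐ ω ∂P, ∀ c, Monotone (fun t => M c t ω) :=
    ae_all_iff.2 fun c => (hM c).path.mono fun ω hω => hω.2.1
  have lhs : ∫ ω, ∏ c, ∏ l ∈ Finset.range m,
      ((φ c).elim 1 (fun d => z d l)) ^ (M c (t (l + 1)) ω - M c (t l) ω) ∂P =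
      ∫ ω, ∏ d, ∏ l ∈ Finset.range m, z d l ^ (N d (t (l + 1)) ω - N d (t l) ω) ∂P := by
    refine integral_congr_ae ?_
    filter_upwards [hpath] with ω hω
    rw [split _ (fun c hc => by simp [hc])]
    refine Finset.prod_congr rfl fun d _ => ?_
    rw [Finset.prod_comm]
    refine Finset.prod_congr rfl fun l _ => ?_
    -- Truncated subtraction commutes with the sum only because every path is monotone.
    rw [hN, hN, ← Finset.sum_tsub_distrib _ fun c _ => hω c (ht (Nat.le_succ l)),
      ← Finset.prod_pow_eq_pow_sum]
    refine Finset.prod_congr rfl fun c hc => ?_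
    rw [(Finset.mem_filter.1 hc).2]
    rfl
  rw [← lhs, key, split _ (fun c hc => by simp [hc])]
  refine Finset.prod_congr rfl fun d _ => ?_
  rw [Finset.prod_comm]
  refine Finset.prod_congr rfl fun l _ => ?_
  rw [← Complex.exp_sum]
  congr 1
  have hcum : cumRate (r' d) (t l) (t (l + 1)) =
      ∑ c with φ c = some d, cumRate (r c) (t l) (t (l + 1)) := by
    unfold cumRate
    rw [← intervalIntegral.integral_finsetSum fun c _ => (hr c).intervalIntegrable _ _]
    exact intervalIntegral.integral_congr fun u _ => hr' d u
  rw [hcum, Complex.ofReal_sum, Finset.sum_mul]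
  refine Finset.sum_congr rfl fun c hc => ?_
  rw [(Finset.mem_filter.1 hc).2]
  rfl

/-! ### Paths of Skellam processes -/

/-- `f` is a linear combination `∑ i ∈ I, i * n i` of counting paths whose sum has unit jumps. -/
structure IsSkellamPath (I : Finset ℤ) (n : ℤ → ℝ≥0 → ℕ) (f : ℝ≥0 → ℤ) : Prop where
  zero_notMem : (0 : ℤ) ∉ I
  zero : ∀ i ∈ I, n i 0 = 0
  mono : ∀ i ∈ I, Monotone (n i)
  rightCont : ∀ i ∈ I, ∀ t, ContinuousWithinAt (n i) (Set.Ici t) t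
  eq_sum : ∀ t, f t = ∑ i ∈ I, i * (n i t : ℤ)
  exists_eq : ∀ t k, k ≤ ∑ i ∈ I, n i t → ∃ s, ∑ i ∈ I, n i s = k

/-- The total number of events of the counting paths `n i`, `i ∈ I`. -/
def total (I : Finset ℤ) (n : ℤ → ℝ≥0 → ℕ) (t : ℝ≥0) : ℕ := ∑ i ∈ I, n i t

namespace IsSkellamPath

variable {I : Finset ℤ} {n : ℤ → ℝ≥0 → ℕ} {f : ℝ≥0 → ℤ}

lemma total_mono (h : IsSkellamPath I n f) : Monotone (total I n) := fun _ _ hst =>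
  Finset.sum_le_sum fun i hi => h.mono i hi hst

lemma total_zero (h : IsSkellamPath I n f) : total I n 0 = 0 :=
  Finset.sum_eq_zero fun i hi => h.zero i hi

lemma exists_total_eq_right (h : IsSkellamPath I n f) (t : ℝ≥0) :
    ∃ u > t, ∀ s ∈ Set.Ico t u, total I n s = total I n t := by
  have h1 : ∀ᶠ s in nhdsWithin t (Set.Ici t), ∀ i ∈ I, n i s = n i t := by
    rw [Filter.eventually_all_finset]
    intro i hi
    have := h.rightCont i hi t
    rw [ContinuousWithinAt, nhds_discrete, Filter.tendsto_pure] at this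
    exact this
  obtain ⟨u, hu, hs⟩ := (mem_nhdsGE_iff_exists_Ico_subset).1 h1
  exact ⟨u, hu, fun s hst => Finset.sum_congr rfl fun i hi => hs hst i hi⟩

lemma eq_of_total_eq (h : IsSkellamPath I n f) {s t : ℝ≥0} (hst : s ≤ t)
    (he : total I n s = total I n t) : ∀ i ∈ I, n i s = n i t :=
  (Finset.sum_eq_sum_iff_of_le fun i hi => h.mono i hi hst).1 he

lemma path_eq_of_total_eq (h : IsSkellamPath I n f) {s t : ℝ≥0}
    (he : total I n s = total I n t) : f s = f t := by
  wlog hst : s ≤ t generalizing s t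
  · exact (this he.symm (le_of_not_ge hst)).symm
  rw [h.eq_sum, h.eq_sum]
  exact Finset.sum_congr rfl fun i hi => by rw [h.eq_of_total_eq hst he i hi]

/-- A sum of natural numbers equal to `1` has exactly one nonzero term: a single component moves,
and the increment of `f` tells which one. -/
lemma exists_unit_step (h : IsSkellamPath I n f) {s t : ℝ≥0}
    (he : total I n t = total I n s + 1) :
    f t - f s ∈ I ∧ ∀ i ∈ I, n i t = n i s + if f t - f s = i then 1 else 0 := by
  have hst : s ≤ t := by
    by_contra hlt
    have := h.total_mono (le_of_not_ge hlt)
    omega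
  have hle : ∀ i ∈ I, n i s ≤ n i t := fun i hi => h.mono i hi hst
  have hsum : ∑ i ∈ I, (n i t - n i s) = 1 := by
    have := Finset.sum_tsub_distrib I hle
    unfold total at he
    omega
  obtain ⟨i, hi, hi1⟩ : ∃ i ∈ I, n i t - n i s ≠ 0 := by
    by_contra! hcon
    rw [Finset.sum_eq_zero hcon] at hsum
    omega
  have hi1' : n i t - n i s = 1 := by
    have := Finset.single_le_sum (f := fun i => n i t - n i s) (fun _ _ => Nat.zero_le _) hi
    simp only [hsum] at this
    omega
  have hother : ∀ j ∈ I, j ≠ i → n j t - n j s = 0 := by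
    intro j hj hji
    rw [← Finset.add_sum_erase I _ hi] at hsum
    have h2 : ∑ x ∈ I.erase i, (n x t - n x s) = 0 := by omega
    exact Finset.sum_eq_zero_iff.1 h2 j (Finset.mem_erase.2 ⟨hji, hj⟩)
  have hf : f t - f s = i := by
    rw [h.eq_sum, h.eq_sum, ← Finset.sum_sub_distrib, Finset.sum_eq_single_of_mem i hi]
    · have : (n i t : ℤ) = n i s + 1 := by have := hle i hi; omega
      rw [this]
      ring
    · intro j hj hji
      have : n j t = n j s := by have := hle j hj; have := hother j hj hji; omega
      rw [this]
      ring
  refine ⟨hf ▸ hi, fun j hj => ?_⟩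
  rw [hf]
  split_ifs with hij
  · subst hij
    have := hle i hi
    omega
  · have := hle j hj
    have := hother j hj (Ne.symm hij)
    omega

/-- The first time at which the total count reaches `k`. -/
def hitTime (I : Finset ℤ) (n : ℤ → ℝ≥0 → ℕ) (k : ℕ) : ℝ≥0 := sInf {t | k ≤ total I n t}

/-- Right continuity makes the infimum attained. The hypothesis `hk` makes the set of times nonempty
and so excludes the junk value `sInf ∅ = 0`. -/
lemma hitTime_le_iff (h : IsSkellamPath I n f) {k : ℕ} {t : ℝ≥0} (hk : k ≤ total I n t) (s : ℝ≥0) :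
    hitTime I n k ≤ s ↔ k ≤ total I n s := by
  have hT : k ≤ total I n (hitTime I n k) := by
    obtain ⟨u, hu, hs⟩ := h.exists_total_eq_right (hitTime I n k)
    obtain ⟨s, hs1, hs2⟩ := exists_lt_of_csInf_lt ⟨t, hk⟩ hu
    rw [← hs s ⟨csInf_le' hs1, hs2⟩]
    exact hs1
  exact ⟨fun hle => hT.trans (h.total_mono hle), fun hle => csInf_le' hle⟩

/-- Level `k` is not skipped, by `exists_eq`, so the total cannot overshoot when it first reaches
`k`. -/
lemma total_hitTime (h : IsSkellamPath I n f) {k : ℕ} {t : ℝ≥0} (hk : k ≤ total I n t) :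
    total I n (hitTime I n k) = k := by
  refine le_antisymm ?_ ((h.hitTime_le_iff hk _).1 le_rfl)
  obtain ⟨s, hs⟩ := h.exists_eq t k hk
  have : hitTime I n k ≤ s := (h.hitTime_le_iff hk s).2 hs.ge
  exact (h.total_mono this).trans hs.le

lemma jump_eq_of_lt (h : IsSkellamPath I n f) {s t : ℝ≥0} (hst : s < t)
    (hs : ∀ u, s ≤ u → u < t → total I n u = total I n s) : jump f t = f t - f s := by
  have : (nhdsWithin t (Set.Iio t)).NeBot := nhdsLT_neBot_of_exists_lt ⟨s, hst⟩
  rw [jump, leftLim_eq_of_tendsto (y := f s)]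
  rw [nhds_discrete, Filter.tendsto_pure]
  filter_upwards [Ioo_mem_nhdsLT hst] with u hu
  exact h.path_eq_of_total_eq (hs u hu.1.le hu.2)

lemma jump_hitTime (h : IsSkellamPath I n f) {k : ℕ} {t : ℝ≥0} (hk : k + 1 ≤ total I n t) :
    jump f (hitTime I n (k + 1)) = f (hitTime I n (k + 1)) - f (hitTime I n k) := by
  have hk' : k ≤ total I n t := by omega
  refine h.jump_eq_of_lt ?_ fun u hu1 hu2 => ?_
  · by_contra hcon
    have := h.total_mono (le_of_not_gt hcon)
    rw [h.total_hitTime hk, h.total_hitTime hk'] at this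
    omega
  · rw [h.total_hitTime hk']
    have h1 := (h.hitTime_le_iff hk' u).1 hu1
    have h2 : ¬ k + 1 ≤ total I n u := fun h3 => hu2.not_ge ((h.hitTime_le_iff hk u).2 h3)
    omega

lemma jump_hitTime_mem (h : IsSkellamPath I n f) {k : ℕ} {t : ℝ≥0} (hk : k + 1 ≤ total I n t) :
    jump f (hitTime I n (k + 1)) ∈ I := by
  rw [h.jump_hitTime hk]
  refine (h.exists_unit_step ?_).1
  rw [h.total_hitTime hk, h.total_hitTime (k := k) (t := t) (by omega)]

/-- If the present level was already reached earlier, the path is constant up to `t` and does not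
jump. Otherwise the jump lies in `I`, which omits `0`. The condition `1 ≤ total I n t` excludes time
`0`, the hitting time of level `0`. -/
lemma jump_ne_zero_iff (h : IsSkellamPath I n f) (t : ℝ≥0) :
    jump f t ≠ 0 ↔ 1 ≤ total I n t ∧ hitTime I n (total I n t) = t := by
  constructor
  · intro hne
    have hle : hitTime I n (total I n t) ≤ t := (h.hitTime_le_iff le_rfl t).2 le_rfl
    by_contra hcon
    apply hne
    have key : ∃ s < t, total I n s = total I n t := by
      rcases hle.eq_or_lt with heq | hlt
      · have h0 : total I n t = 0 := by
          by_contra h0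
          exact hcon ⟨by omega, heq⟩
        rcases eq_or_ne t 0 with rfl | ht
        · exfalso
          apply hne
          rw [jump, leftLim_eq_of_isBot fun x => zero_le, sub_self]
        · exact ⟨0, pos_iff_ne_zero.2 ht, by rw [h.total_zero, h0]⟩
      · exact ⟨_, hlt, h.total_hitTime le_rfl⟩
    obtain ⟨s, hst, hs⟩ := key
    rw [h.jump_eq_of_lt hst fun u hu1 hu2 => ?_, h.path_eq_of_total_eq hs, sub_self]
    have h1 := h.total_mono hu1
    have h2 := h.total_mono hu2.le
    omega
  · rintro ⟨h1, h2⟩ h0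
    obtain ⟨k, hk⟩ : ∃ k, total I n t = k + 1 := ⟨_, (Nat.sub_add_cancel h1).symm⟩
    rw [hk] at h2
    have := h.jump_hitTime_mem hk.ge
    rw [h2, h0] at this
    exact h.zero_notMem this

/-- Hitting times map the levels `1, …, total I n t` bijectively onto the jump times in `[0, t]`. -/
lemma jumpCount_eq (h : IsSkellamPath I n f) : jumpCount f = total I n := by
  funext t
  have hset : {s : ℝ≥0 | s ≤ t ∧ jump f s ≠ 0} =
      hitTime I n '' (Finset.Icc 1 (total I n t) : Finset ℕ) := by
    ext s
    simp only [Set.mem_ofPred_eq, h.jump_ne_zero_iff, Set.mem_image, Finset.coe_Icc, Set.mem_Icc]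
    constructor
    · rintro ⟨hst, h1, h2⟩
      exact ⟨_, ⟨h1, h.total_mono hst⟩, h2⟩
    · rintro ⟨k, ⟨hk1, hk2⟩, rfl⟩
      rw [h.total_hitTime hk2]
      exact ⟨(h.hitTime_le_iff hk2 t).2 hk2, hk1, rfl⟩
  rw [jumpCount, hset, Set.InjOn.ncard_image, Set.ncard_coe_finset, Nat.card_Icc,
    Nat.add_sub_cancel]
  intro a ha b hb hab
  have ha' := (Finset.mem_Icc.1 (Finset.mem_coe.1 ha)).2
  have hb' := (Finset.mem_Icc.1 (Finset.mem_coe.1 hb)).2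
  rw [← h.total_hitTime ha', hab, h.total_hitTime hb']

lemma jumpTime_eq (h : IsSkellamPath I n f) : jumpTime f = hitTime I n := by
  funext k
  rw [jumpTime, h.jumpCount_eq, hitTime]

lemma jumpSize_succ (h : IsSkellamPath I n f) {k : ℕ} {t : ℝ≥0} (hk : k + 1 ≤ total I n t) :
    jumpSize f (k + 1) = f (hitTime I n (k + 1)) - f (hitTime I n k) := by
  rw [jumpSize, h.jumpTime_eq, h.jump_hitTime hk]

lemma jumpSize_mem (h : IsSkellamPath I n f) {k : ℕ} {t : ℝ≥0} (hk1 : 1 ≤ k)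
    (hk : k ≤ total I n t) : jumpSize f k ∈ I := by
  obtain ⟨k, rfl⟩ : ∃ l, k = l + 1 := ⟨_, (Nat.sub_add_cancel hk1).symm⟩
  rw [jumpSize, h.jumpTime_eq]
  exact h.jump_hitTime_mem hk

/-- Induction over levels: the step from level `k` to `k + 1` raises exactly the component named by
the jump size. Thus the `n i` are recovered from `f`. -/
lemma card_jumpSize_eq (h : IsSkellamPath I n f) {i : ℤ} (hi : i ∈ I) (t : ℝ≥0) :
    ((Finset.Icc 1 (total I n t)).filter fun k => jumpSize f k = i).card = n i t := by
  have key : ∀ k ≤ total I n t,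
      ((Finset.Icc 1 k).filter fun k => jumpSize f k = i).card = n i (hitTime I n k) := by
    intro k
    induction k with
    | zero =>
      intro _
      have h0 : total I n 0 = total I n (hitTime I n 0) := by
        rw [h.total_hitTime (Nat.zero_le (total I n t)), h.total_zero]
      rw [← h.eq_of_total_eq zero_le h0 i hi, h.zero i hi]
      simp
    | succ k ih =>
      intro hk
      have hk' : k ≤ total I n t := by omega
      have hstep := (h.exists_unit_step (s := hitTime I n k) (t := hitTime I n (k + 1))
        (by rw [h.total_hitTime hk, h.total_hitTime hk'])).2 i hi
      rw [hstep, ← ih hk', ← h.jumpSize_succ hk,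
        ← Finset.insert_Icc_right_eq_Icc_add_one (by omega), Finset.filter_insert]
      split_ifs
      · rw [Finset.card_insert_of_notMem (by simp)]
      · rfl
  rw [key _ le_rfl]
  exact h.eq_of_total_eq ((h.hitTime_le_iff le_rfl t).2 le_rfl) (h.total_hitTime le_rfl) i hi

lemma card_jumpSize_Ioc (h : IsSkellamPath I n f) {i : ℤ} (hi : i ∈ I) {s t : ℝ≥0} (hst : s ≤ t) :
    ((Finset.Ioc (total I n s) (total I n t)).filter fun k => jumpSize f k = i).card =
      n i t - n i s := by
  have hle := h.total_mono hst
  rw [← h.card_jumpSize_eq hi t, ← h.card_jumpSize_eq hi s, ← Finset.card_sdiff_of_subset]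
  · congr 1
    ext k
    simp only [Finset.mem_filter, Finset.mem_Ioc, Finset.mem_sdiff, Finset.mem_Icc]
    constructor
    · rintro ⟨⟨h1, h2⟩, h3⟩
      exact ⟨⟨⟨by omega, h2⟩, h3⟩, fun h4 => by omega⟩
    · rintro ⟨⟨⟨h1, h2⟩, h3⟩, h4⟩
      refine ⟨⟨?_, h2⟩, h3⟩
      by_contra h5
      exact h4 ⟨⟨h1, by omega⟩, h3⟩
  · intro k
    simp only [Finset.mem_filter, Finset.mem_Icc]
    rintro ⟨⟨h1, h2⟩, h3⟩
    exact ⟨⟨h1, h2.trans hle⟩, h3⟩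

end IsSkellamPath

/-! ### Measurability of the jumps in terms of the path -/

/-- A countable description of the paths with at least `k` jumps in `[0, t]`. -/
def AtLeastJumps : ℕ → ℝ≥0 → (ℝ≥0 → ℤ) → Prop
  | 0, _, _ => True
  | k + 1, t, f => ∃ a : ℕ, TopologicalSpace.denseSeq ℝ≥0 a < t ∧
      AtLeastJumps k (TopologicalSpace.denseSeq ℝ≥0 a) f ∧
      (f t ≠ f (TopologicalSpace.denseSeq ℝ≥0 a) ∨ ∃ b : ℕ,
        TopologicalSpace.denseSeq ℝ≥0 a < TopologicalSpace.denseSeq ℝ≥0 b ∧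
        TopologicalSpace.denseSeq ℝ≥0 b ≤ t ∧
        f (TopologicalSpace.denseSeq ℝ≥0 b) ≠ f (TopologicalSpace.denseSeq ℝ≥0 a))

/-- A countable description of the paths whose `k`-th jump exists and is equal to `x`. -/
def JumpSizeIs (k : ℕ) (x : ℤ) (f : ℝ≥0 → ℤ) : Prop :=
  ∃ a b : ℕ, (AtLeastJumps (k - 1) (TopologicalSpace.denseSeq ℝ≥0 a) f ∧
    ¬ AtLeastJumps k (TopologicalSpace.denseSeq ℝ≥0 a) f) ∧
    (AtLeastJumps k (TopologicalSpace.denseSeq ℝ≥0 b) f ∧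
    ¬ AtLeastJumps (k + 1) (TopologicalSpace.denseSeq ℝ≥0 b) f) ∧
    f (TopologicalSpace.denseSeq ℝ≥0 b) - f (TopologicalSpace.denseSeq ℝ≥0 a) = x

lemma measurableSet_atLeastJumps (k : ℕ) (t : ℝ≥0) : MeasurableSet {f | AtLeastJumps k t f} := by
  induction k generalizing t with
  | zero => simp [AtLeastJumps]
  | succ k ih =>
    have hne : ∀ s u : ℝ≥0, MeasurableSet {f : ℝ≥0 → ℤ | f s ≠ f u} := fun s u =>
      (measurableSet_eq_fun (measurable_pi_apply s) (measurable_pi_apply u)).compl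
    simp only [AtLeastJumps]
    measurability

lemma measurableSet_jumpSizeIs (k : ℕ) (x : ℤ) : MeasurableSet {f | JumpSizeIs k x f} := by
  have hne : ∀ s u : ℝ≥0, MeasurableSet {f : ℝ≥0 → ℤ | f s - f u = x} := fun s u =>
    measurableSet_eq_fun ((measurable_pi_apply s).sub (measurable_pi_apply u)) measurable_const
  have h1 := measurableSet_atLeastJumps
  have h2 : ∀ k t, MeasurableSet {f : ℝ≥0 → ℤ | ¬ AtLeastJumps k t f} := fun k t => (h1 k t).compl
  unfold JumpSizeIs
  simp only [Set.ofPred_exists, Set.ofPred_and]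
  refine MeasurableSet.iUnion fun a => MeasurableSet.iUnion fun b => ?_
  exact ((h1 _ _).inter (h2 _ _)).inter (((h1 _ _).inter (h2 _ _)).inter (hne _ _))

namespace IsSkellamPath

variable {I : Finset ℤ} {n : ℤ → ℝ≥0 → ℕ} {f : ℝ≥0 → ℤ}

lemma exists_denseSeq_between {s t : ℝ≥0} (hst : s < t) :
    ∃ a : ℕ, s < TopologicalSpace.denseSeq ℝ≥0 a ∧ TopologicalSpace.denseSeq ℝ≥0 a < t := by
  obtain ⟨_, ⟨a, rfl⟩, h1, h2⟩ :=
    (TopologicalSpace.denseRange_denseSeq ℝ≥0).exists_between hst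
  exact ⟨a, h1, h2⟩

lemma hitTime_lt_succ (h : IsSkellamPath I n f) {k : ℕ} {t : ℝ≥0} (hk : k + 1 ≤ total I n t) :
    hitTime I n k < hitTime I n (k + 1) := by
  have hk' : k ≤ total I n t := by omega
  by_contra hcon
  have := h.total_mono (le_of_not_gt hcon)
  rw [h.total_hitTime hk, h.total_hitTime hk'] at this
  omega

lemma total_eq_of_between (h : IsSkellamPath I n f) {k : ℕ} {s t : ℝ≥0}
    (hk : k + 1 ≤ total I n t) (h1 : hitTime I n k ≤ s) (h2 : s < hitTime I n (k + 1)) :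
    total I n s = k := by
  have h3 := (h.hitTime_le_iff (k := k) (t := t) (by omega) s).1 h1
  have h4 : ¬ k + 1 ≤ total I n s := fun h5 => h2.not_ge ((h.hitTime_le_iff hk s).2 h5)
  omega

/-- A change of `f` forces the total to grow, and a growth by one changes `f` because `0 ∉ I`. A
dense time between hits `k` and `k + 1` serves as `a`. The value `f t` is needed when hit `k + 1`
occurs at `t` itself; otherwise a dense time just after the hit serves as `b`. -/
lemma atLeastJumps_iff (h : IsSkellamPath I n f) (k : ℕ) (t : ℝ≥0) :
    AtLeastJumps k t f ↔ k ≤ total I n t := by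
  induction k generalizing t with
  | zero => simp [AtLeastJumps]
  | succ k ih =>
    have hlt : ∀ s u : ℝ≥0, s < u → f u ≠ f s → total I n s < total I n u := by
      intro s u hsu hne
      refine lt_of_le_of_ne (h.total_mono hsu.le) fun he => hne ?_
      exact (h.path_eq_of_total_eq he).symm
    constructor
    · rintro ⟨a, hat, hk, hne⟩
      have hk' := (ih _).1 hk
      rcases hne with hne | ⟨b, hab, hbt, hne⟩
      · have := hlt _ _ hat hne
        omega
      · have := hlt _ _ hab hne
        have := h.total_mono hbt
        omega
    · intro hk
      have hT := (h.hitTime_le_iff hk t).2 hk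
      obtain ⟨a, ha1, ha2⟩ := exists_denseSeq_between (h.hitTime_lt_succ hk)
      have hta := h.total_eq_of_between hk ha1.le ha2
      refine ⟨a, ha2.trans_le hT, (ih _).2 hta.ge, ?_⟩
      obtain ⟨u, hu, hcon⟩ := h.exists_total_eq_right (hitTime I n (k + 1))
      have hne : ∀ s, total I n s = k + 1 →
          f s ≠ f (TopologicalSpace.denseSeq ℝ≥0 a) := by
        intro s hs he
        have := (h.exists_unit_step (s := TopologicalSpace.denseSeq ℝ≥0 a) (t := s)
          (by rw [hs, hta])).1
        rw [he, sub_self] at this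
        exact h.zero_notMem this
      rcases hT.eq_or_lt with heq | hlt'
      · left
        refine hne t ?_
        rw [← heq, h.total_hitTime hk]
      · right
        obtain ⟨b, hb1, hb2⟩ := exists_denseSeq_between (lt_min hlt' hu)
        refine ⟨b, ha2.trans hb1, (hb2.trans_le (min_le_left _ _)).le, hne _ ?_⟩
        rw [hcon _ ⟨hb1.le, hb2.trans_le (min_le_right _ _)⟩, h.total_hitTime hk]

/-- The path depends only on the level, so any dense times at levels `k - 1` and `k` show the same
difference. -/
lemma jumpSizeIs_iff (h : IsSkellamPath I n f) {k : ℕ} {t : ℝ≥0} (hk1 : 1 ≤ k)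
    (hk : k ≤ total I n t) (x : ℤ) : JumpSizeIs k x f ↔ jumpSize f k = x := by
  obtain ⟨k, rfl⟩ : ∃ l, k = l + 1 := ⟨_, (Nat.sub_add_cancel hk1).symm⟩
  have hk' : k ≤ total I n t := by omega
  simp only [JumpSizeIs, h.atLeastJumps_iff, Nat.add_sub_cancel]
  constructor
  · rintro ⟨a, b, ⟨ha1, ha2⟩, ⟨hb1, hb2⟩, rfl⟩
    rw [h.jumpSize_succ hk]
    congr 1
    · refine h.path_eq_of_total_eq ?_
      rw [h.total_hitTime hk]
      omega
    · refine h.path_eq_of_total_eq ?_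
      rw [h.total_hitTime hk']
      omega
  · rintro rfl
    obtain ⟨a, ha1, ha2⟩ := exists_denseSeq_between (h.hitTime_lt_succ hk)
    have hta := h.total_eq_of_between hk ha1.le ha2
    obtain ⟨u, hu, hcon⟩ := h.exists_total_eq_right (hitTime I n (k + 1))
    obtain ⟨b, hb1, hb2⟩ := exists_denseSeq_between hu
    have htb := hcon _ ⟨hb1.le, hb2⟩
    rw [h.total_hitTime hk] at htb
    refine ⟨a, b, ⟨hta.ge, by omega⟩, ⟨htb.ge, by omega⟩, ?_⟩
    rw [h.jumpSize_succ hk]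
    congr 1
    · exact h.path_eq_of_total_eq (by rw [htb, h.total_hitTime hk])
    · exact h.path_eq_of_total_eq (by rw [hta, h.total_hitTime hk'])

end IsSkellamPath

/-! ### Almost all paths have unit jumps -/

lemma isRate_sum {ι : Type*} (s : Finset ι) {r : ι → ℝ → ℝ} (hr : ∀ i ∈ s, IsRate (r i)) :
    IsRate (fun u => ∑ i ∈ s, r i u) := by
  refine ⟨fun u hu => Finset.sum_nonneg fun i hi => (hr i hi).1 u hu, fun t ht => ?_⟩
  have := IntervalIntegrable.sum s fun i hi => (hr i hi).2 t ht
  convert! this using 1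
  ext u
  simp

/-- The probability is 1 - e^{-a}(1 + a), and e^{-a} ≥ 1 - a bounds it by 1 - (1 - a)(1 + a) = a².
-/
lemma poissonMeasure_two_le (a : ℝ≥0) :
    poissonMeasure a {n | 2 ≤ n} ≤ ENNReal.ofReal ((a : ℝ) ^ 2) := by
  have hcompl : {n : ℕ | 2 ≤ n} = ({0, 1} : Set ℕ)ᶜ := by
    ext n
    simp only [Set.mem_ofPred_eq, Set.mem_compl_iff, Set.mem_insert_iff, Set.mem_singleton_iff]
    omega
  have h01 : (poissonMeasure a).real ({0, 1} : Set ℕ) = Real.exp (-a) * (1 + a) := by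
    rw [show ({0, 1} : Set ℕ) = {0} ∪ {1} from rfl,
      measureReal_union (by simp) (MeasurableSet.singleton 1), poissonMeasure_real_singleton,
      poissonMeasure_real_singleton]
    simp
    ring
  rw [← ENNReal.ofReal_toReal (measure_ne_top (poissonMeasure a) _)]
  refine ENNReal.ofReal_le_ofReal ?_
  rw [hcompl, ← measureReal_def, probReal_compl_eq_one_sub (by measurability), h01]
  have h1 : 1 - (a : ℝ) ≤ Real.exp (-a) := by
    have := Real.add_one_le_exp (-(a : ℝ))
    linarith
  have h2 : (1 - (a : ℝ)) * (1 + a) ≤ Real.exp (-a) * (1 + a) :=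
    mul_le_mul_of_nonneg_right h1 (by positivity)
  nlinarith

lemma exists_eq_of_unit_steps (g : ℕ → ℕ) (h0 : g 0 = 0) (m : ℕ)
    (hstep : ∀ l < m, g (l + 1) ≤ g l + 1) (k : ℕ) (hk : k ≤ g m) : ∃ l, g l = k := by
  induction m with
  | zero => exact ⟨0, by omega⟩
  | succ m ih =>
    by_cases hle : k ≤ g m
    · exact ih (fun l hl => hstep l (by omega)) hle
    · have := hstep m (by omega)
      exact ⟨m + 1, by omega⟩

lemma cumRate_eq_sub {R : ℝ → ℝ} (hR : IsRate R) (s t : ℝ≥0) :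
    cumRate R s t = cumRate R 0 t - cumRate R 0 s := by
  unfold cumRate
  rw [intervalIntegral.integral_interval_sub_left (hR.intervalIntegrable _ _)
    (hR.intervalIntegrable _ _)]

/-- The primitive of `R` is uniformly continuous on `[0, T]`, so a sufficiently fine equidistant
grid works. -/
lemma exists_fine_grid {R : ℝ → ℝ} (hR : IsRate R) (T : ℝ≥0) {ε : ℝ} (hε : 0 < ε) :
    ∃ t : ℕ → ℝ≥0, ∃ m : ℕ, Monotone t ∧ t 0 = 0 ∧ t m = T ∧
      ∀ l < m, cumRate R (t l) (t (l + 1)) ≤ ε := by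
  have hcont : ContinuousOn (fun x => ∫ u in (0 : ℝ)..x, R u) (Set.uIcc 0 (T : ℝ)) := by
    refine intervalIntegral.continuousOn_primitive_interval ?_
    exact (intervalIntegrable_iff' (by simp)).1 (hR.2 T T.2)
  rw [Set.uIcc_of_le T.coe_nonneg] at hcont
  have huc := isCompact_Icc.uniformContinuousOn_of_continuous hcont
  obtain ⟨δ, hδ, hδε⟩ := Metric.uniformContinuousOn_iff.1 huc ε hε
  obtain ⟨m, hm⟩ := exists_nat_gt ((T : ℝ) / δ)
  have hm0 : 0 < m := by
    have : (0 : ℝ) < m := lt_of_le_of_lt (by positivity) hm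
    exact_mod_cast this
  have hm0' : (0 : ℝ) < m := by exact_mod_cast hm0
  have hTm : (T : ℝ) / m < δ := by
    rw [div_lt_iff₀ hδ] at hm
    rw [div_lt_iff₀ hm0']
    linarith
  refine ⟨fun l => T * l / m, m, ?_, by simp, ?_, fun l hl => ?_⟩
  · intro a b hab
    dsimp only
    gcongr
  · have : (m : ℝ≥0) ≠ 0 := by exact_mod_cast hm0.ne'
    field_simp
  · have hmem : ∀ k ≤ m, ((T * k / m : ℝ≥0) : ℝ) ∈ Set.Icc (0 : ℝ) T := by
      intro k hk
      refine ⟨NNReal.coe_nonneg _, ?_⟩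
      push_cast
      rw [div_le_iff₀ hm0']
      have : (k : ℝ) ≤ m := by exact_mod_cast hk
      exact mul_le_mul_of_nonneg_left this T.2
    have h1 := hδε _ (hmem (l + 1) hl) _ (hmem l hl.le) (by
      rw [Real.dist_eq]
      push_cast
      rw [show (T : ℝ) * (l + 1) / m - T * l / m = T / m by ring, abs_of_nonneg (by positivity)]
      exact hTm)
    rw [cumRate_eq_sub hR]
    rw [Real.dist_eq] at h1
    exact (le_abs_self _).trans h1.le

/-- A skipped level before `T` puts two events into one cell of any grid. The probability of this is
at most the sum of the squared cell parameters, hence at most the mesh bound times the total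
parameter, which is arbitrarily small. -/
lemma ae_exists_eq_of_hasLaw {P : Measure Ω} {G : ℝ≥0 → Ω → ℕ} {R : ℝ → ℝ} (hR : IsRate R)
    (hG : ∀ᵐ ω ∂P, G 0 ω = 0 ∧ Monotone (fun t => G t ω))
    (hlaw : ∀ s t : ℝ≥0, s ≤ t →
      HasLaw (fun ω => G t ω - G s ω) (poissonMeasure (cumRate R s t).toNNReal) P) :
    ∀ᵐ ω ∂P, ∀ t k, k ≤ G t ω → ∃ s, G s ω = k := by
  have main : ∀ T : ℝ≥0,
      P {ω | ¬ ((G 0 ω = 0 ∧ Monotone (fun t => G t ω)) → ∀ k ≤ G T ω, ∃ s, G s ω = k)} = 0 := by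
    intro T
    refine le_antisymm (ENNReal.le_of_forall_pos_le_add fun η hη _ => ?_) bot_le
    rw [zero_add]
    have hΛ : 0 ≤ cumRate R 0 T := hR.cumRate_nonneg bot_le
    -- The summand `1` avoids division by zero when the total parameter vanishes.
    obtain ⟨t, m, ht, h0, hm, hε⟩ := exists_fine_grid hR T
      (ε := η / (cumRate R 0 T + 1)) (by positivity)
    have hsub : {ω | ¬ ((G 0 ω = 0 ∧ Monotone (fun t => G t ω)) →
        ∀ k ≤ G T ω, ∃ s, G s ω = k)} ⊆
        ⋃ l ∈ Finset.range m, {ω | 2 ≤ G (t (l + 1)) ω - G (t l) ω} := by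
      intro ω hω
      by_contra hcon
      simp only [Set.mem_iUnion, Finset.mem_range, Set.mem_ofPred_eq, not_exists] at hcon
      refine hω fun hω' k hk => ?_
      rw [← hm] at hk
      obtain ⟨l, hl⟩ := exists_eq_of_unit_steps (fun l => G (t l) ω) (by simp [h0, hω'.1]) m
        (fun l hl => by have := hcon l hl; omega) k hk
      exact ⟨_, hl⟩
    have hinc : ∀ l, 0 ≤ cumRate R (t l) (t (l + 1)) := fun l =>
      hR.cumRate_nonneg (ht (Nat.le_succ l))
    calc P _ ≤ ∑ l ∈ Finset.range m, P {ω | 2 ≤ G (t (l + 1)) ω - G (t l) ω} :=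
          (measure_mono hsub).trans (measure_biUnion_finset_le _ _)
      _ ≤ ∑ l ∈ Finset.range m, ENNReal.ofReal (cumRate R (t l) (t (l + 1)) ^ 2) := by
          refine Finset.sum_le_sum fun l _ => ?_
          have h1 := (hlaw _ _ (ht (Nat.le_succ l))).measure_eq
            (p := fun n => 2 ≤ n) (by measurability)
          rw [h1]
          have h2 := poissonMeasure_two_le (cumRate R (t l) (t (l + 1))).toNNReal
          rwa [Real.coe_toNNReal _ (hinc l)] at h2
      _ = ENNReal.ofReal (∑ l ∈ Finset.range m, cumRate R (t l) (t (l + 1)) ^ 2) :=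
          (ENNReal.ofReal_sum_of_nonneg fun l _ => sq_nonneg _).symm
      _ ≤ ENNReal.ofReal η := by
          refine ENNReal.ofReal_le_ofReal ?_
          calc ∑ l ∈ Finset.range m, cumRate R (t l) (t (l + 1)) ^ 2
              ≤ ∑ l ∈ Finset.range m,
                  η / (cumRate R 0 T + 1) * cumRate R (t l) (t (l + 1)) := by
                refine Finset.sum_le_sum fun l hl => ?_
                rw [sq]
                exact mul_le_mul_of_nonneg_right (hε l (Finset.mem_range.1 hl)) (hinc l)
            _ = η / (cumRate R 0 T + 1) * cumRate R 0 T := by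
                rw [← Finset.mul_sum]
                congr 1
                simp_rw [fun l => cumRate_eq_sub hR (t l) (t (l + 1))]
                rw [Finset.sum_range_sub (fun l => cumRate R 0 (t l)), hm, h0]
                simp [cumRate]
            _ ≤ η := by
                rw [div_mul_eq_mul_div, div_le_iff₀ (by positivity)]
                exact mul_le_mul_of_nonneg_left (by linarith) η.2
      _ = η := ENNReal.ofReal_coe_nnreal
  have hall : ∀ᵐ ω ∂P, ∀ T : ℕ, (G 0 ω = 0 ∧ Monotone (fun t => G t ω)) →
      ∀ k ≤ G T ω, ∃ s, G s ω = k := ae_all_iff.2 fun T => main T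
  filter_upwards [hall, hG] with ω hω hω' t k hk
  obtain ⟨T, hT⟩ := exists_nat_ge t
  exact hω T hω' k (hk.trans (hω'.2 hT))

lemma ae_isSkellamPath {P : Measure Ω} [IsProbabilityMeasure P] {I : Finset ℤ}
    {lam : ℤ → ℝ → ℝ} {S : ℝ≥0 → Ω → ℤ} (h0 : (0 : ℤ) ∉ I) (hlam : ∀ i ∈ I, IsRate (lam i))
    {N : ℤ → ℝ≥0 → Ω → ℕ} (hN : ∀ i ∈ I, IsPoissonProcess (N i) (lam i) P)
    (hind : iIndepFun (fun (i : I) (ω : Ω) (t : ℝ≥0) => N i t ω) P)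
    (hS : ∀ᵐ ω ∂P, ∀ t, S t ω = ∑ i ∈ I, i * (N i t ω : ℤ)) :
    ∀ᵐ ω ∂P, IsSkellamPath I (fun i t => N i t ω) (path S ω) := by
  have hpath : ∀ᵐ ω ∂P, ∀ i : I, N i 0 ω = 0 ∧ Monotone (fun t => N i t ω) ∧
      ∀ t, ContinuousWithinAt (fun s => N i s ω) (Set.Ici t) t :=
    ae_all_iff.2 fun i => (hN i i.2).path
  have hP := hasPoissonIncrements_of_iIndepFun (N := fun (i : I) => N i) (r := fun i : I => lam i)
    (fun i => hlam i i.2) (fun i => hN i i.2) hind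
  -- Superposition onto a one-point index type makes the total count Poisson, so that
  -- `ae_exists_eq_of_hasLaw` applies to it.
  have hT := hP.superpose (fun i => hlam i i.2)
    (fun i => ⟨(hN i i.2).measurable, (hN i i.2).path⟩) (fun _ => some ())
    (N := fun _ t ω => ∑ i : I, N i t ω) (r' := fun _ u => ∑ i : I, lam i u)
    (fun _ _ _ => by simp) (fun _ _ => by simp)
  have hR : IsRate (fun u => ∑ i : I, lam i u) := isRate_sum _ fun i _ => hlam i i.2
  have hunit := ae_exists_eq_of_hasLaw (P := P) (G := fun t ω => ∑ i : I, N i t ω) hR (by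
      filter_upwards [hpath] with ω hω
      exact ⟨Finset.sum_eq_zero fun i _ => (hω i).1,
        fun s t hst => Finset.sum_le_sum fun i _ => (hω i).2.1 hst⟩)
    (fun s t hst => hT.hasLaw (fun _ => hR)
      (fun _ t => Finset.measurable_sum _ fun i _ => (hN i i.2).measurable t) () hst)
  filter_upwards [hpath, hunit, hS] with ω h1 h2 h3
  have hsum : ∀ t, ∑ i : I, N i t ω = ∑ i ∈ I, N i t ω := fun t =>
    Finset.sum_coe_sort I (fun i => N i t ω)
  simp only [hsum] at h2
  exact ⟨h0, fun i hi => (h1 ⟨i, hi⟩).1, fun i hi => (h1 ⟨i, hi⟩).2.1,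
    fun i hi => (h1 ⟨i, hi⟩).2.2, h3, h2⟩

/-! ### The marks given the jumps -/

lemma comap_path_le {S : ℝ≥0 → Ω → ℤ} (hS : ∀ t, Measurable (S t)) :
    MeasurableSpace.comap (path S) MeasurableSpace.pi ≤ ‹MeasurableSpace Ω› :=
  (measurable_pi_lambda _ hS : Measurable (path S)).comap_le

/-- On `A` the jump sizes are deterministic, so the conditional probability prescribed by `condLaw`
is constant there and integrates to the product. -/
lemma measureReal_inter_marks_eq {P : Measure Ω} [IsProbabilityMeasure P] {q : ℕ → ℤ → ℝ}
    {S : ℝ≥0 → Ω → ℤ} {Y : ℕ → Ω → ℕ} (hS : ∀ t, Measurable (S t)) (hY : IsSplitting q S Y P)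
    {A : Set Ω} (hA : MeasurableSet[MeasurableSpace.comap (path S) MeasurableSpace.pi] A) {n : ℕ}
    {x : ℕ → ℤ} (hx : ∀ᵐ ω ∂P, ω ∈ A → (∃ t, n ≤ jumpCount (path S ω) t) ∧
      ∀ k ∈ Finset.Icc 1 n, jumpSize (path S ω) k = x k) (y : ℕ → ℕ) :
    P.real (A ∩ {ω | ∀ k ∈ Finset.Icc 1 n, Y k ω = y k}) =
      P.real A * ∏ k ∈ Finset.Icc 1 n, q (y k) (x k) := by
  have hm := comap_path_le hS
  have hB : MeasurableSet {ω | ∀ k ∈ Finset.Icc 1 n, Y k ω = y k} := by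
    have : {ω | ∀ k ∈ Finset.Icc 1 n, Y k ω = y k} =
        ⋂ k ∈ Finset.Icc 1 n, {ω | Y k ω = y k} := by
      ext; simp
    rw [this]
    exact Finset.measurableSet_biInter _ fun k _ => measurableSet_eq_fun (hY.measurable k)
      measurable_const
  have h1 := setIntegral_condExp (μ := P) hm (f := Set.indicator
    {ω | ∀ k ∈ Finset.Icc 1 n, Y k ω = y k} (fun _ => (1 : ℝ)))
    ((integrable_const 1).indicator hB) hA
  rw [setIntegral_indicator hB, setIntegral_const, smul_eq_mul, mul_one] at h1
  rw [← h1, setIntegral_congr_ae (g := fun _ => ∏ k ∈ Finset.Icc 1 n, q (y k) (x k)) (hm _ hA),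
    setIntegral_const, smul_eq_mul]
  filter_upwards [hx, hY.condLaw n y] with ω h2 h3 hω
  rw [h3 (h2 hω).1]
  exact Finset.prod_congr rfl fun k hk => by rw [(h2 hω).2 k hk]

/-- The event that the first `n` jumps are `x 1, …, x n`. -/
def jumpsEvent {Ω : Type*} (S : ℝ≥0 → Ω → ℤ) (n : ℕ) (x : Finset.Icc 1 n → ℤ) : Set Ω :=
  {ω | ∀ k : Finset.Icc 1 n, JumpSizeIs k (x k) (path S ω)}

lemma measurableSet_jumpsEvent {Ω : Type*} (S : ℝ≥0 → Ω → ℤ) (n : ℕ) (x : Finset.Icc 1 n → ℤ) :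
    MeasurableSet[MeasurableSpace.comap (path S) MeasurableSpace.pi] (jumpsEvent S n x) := by
  refine ⟨⋂ k : Finset.Icc 1 n, {f | JumpSizeIs k (x k) f},
    MeasurableSet.iInter fun k => measurableSet_jumpSizeIs _ _, ?_⟩
  ext ω
  simp [jumpsEvent]

lemma IsSkellamPath.exists_le_total_of_jumpSizeIs {I : Finset ℤ} {n : ℤ → ℝ≥0 → ℕ}
    {f : ℝ≥0 → ℤ} (h : IsSkellamPath I n f) {k : ℕ} {x : ℤ} (hx : JumpSizeIs k x f) :
    ∃ t, k ≤ total I n t := by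
  obtain ⟨_, b, _, ⟨hb, _⟩, _⟩ := hx
  exact ⟨_, (h.atLeastJumps_iff _ _).1 hb⟩

/-- There are countably many choices of jump sizes and marks. One whose last mark is too large has
probability zero, since the last factor `q` vanishes. -/
lemma ae_mark_le_natAbs {P : Measure Ω} [IsProbabilityMeasure P] {I : Finset ℤ} {q : ℕ → ℤ → ℝ}
    {S : ℝ≥0 → Ω → ℤ} {Y : ℕ → Ω → ℕ} {N : ℤ → ℝ≥0 → Ω → ℕ} (hS : ∀ t, Measurable (S t))
    (hq : IsSplitRule I q) (hY : IsSplitting q S Y P)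
    (hpath : ∀ᵐ ω ∂P, IsSkellamPath I (fun i t => N i t ω) (path S ω)) :
    ∀ᵐ ω ∂P, ∀ k, 1 ≤ k → ∀ t, k ≤ jumpCount (path S ω) t →
      Y k ω ≤ (jumpSize (path S ω) k).natAbs := by
  have hnull : ∀ (k : ℕ) (hk : 1 ≤ k) (x : Finset.Icc 1 k → I) (y : Finset.Icc 1 k → ℕ),
      ∀ᵐ ω ∂P, (x ⟨k, Finset.mem_Icc.2 ⟨hk, le_rfl⟩⟩ : ℤ).natAbs <
        y ⟨k, Finset.mem_Icc.2 ⟨hk, le_rfl⟩⟩ →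
        ω ∈ jumpsEvent S k (fun j => x j) → ¬ ∀ j : Finset.Icc 1 k, Y j ω = y j := by
    intro k hk x y
    by_cases hlt : (x ⟨k, Finset.mem_Icc.2 ⟨hk, le_rfl⟩⟩ : ℤ).natAbs <
        y ⟨k, Finset.mem_Icc.2 ⟨hk, le_rfl⟩⟩
    swap
    · exact Filter.Eventually.of_forall fun ω h => absurd h hlt
    -- The value `0` outside `1, …, k` is arbitrary and never enters the product.
    have hval : ∀ j (hj : j ∈ Finset.Icc 1 k),
        Function.extend Subtype.val (fun j => (x j : ℤ)) 0 j = x ⟨j, hj⟩ := fun j hj =>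
      Subtype.val_injective.extend_apply (fun j => (x j : ℤ)) 0 ⟨j, hj⟩
    have hval' : ∀ j (hj : j ∈ Finset.Icc 1 k),
        Function.extend Subtype.val y 0 j = y ⟨j, hj⟩ := fun j hj =>
      Subtype.val_injective.extend_apply y 0 ⟨j, hj⟩
    have h1 := measureReal_inter_marks_eq hS hY (measurableSet_jumpsEvent S k (fun j => x j))
      (n := k) (x := Function.extend Subtype.val (fun j => (x j : ℤ)) 0) (by
        filter_upwards [hpath] with ω hω hmem
        obtain ⟨t, ht⟩ := hω.exists_le_total_of_jumpSizeIs
          (hmem ⟨k, Finset.mem_Icc.2 ⟨hk, le_rfl⟩⟩)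
        refine ⟨⟨t, by rwa [hω.jumpCount_eq]⟩, fun j hj => ?_⟩
        rw [hval j hj]
        exact (hω.jumpSizeIs_iff (Finset.mem_Icc.1 hj).1
          ((Finset.mem_Icc.1 hj).2.trans ht) _).1 (hmem ⟨j, hj⟩))
      (Function.extend Subtype.val y 0)
    rw [Finset.prod_eq_zero (Finset.mem_Icc.2 ⟨hk, le_rfl⟩), mul_zero,
      measureReal_eq_zero_iff] at h1
    · have h2 := measure_eq_zero_iff_ae_notMem.1 h1
      filter_upwards [h2] with ω hω _ hmem hall
      refine hω ⟨hmem, fun j hj => ?_⟩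
      rw [hval' j hj]
      exact hall ⟨j, hj⟩
    · rw [hval k (Finset.mem_Icc.2 ⟨hk, le_rfl⟩), hval' k (Finset.mem_Icc.2 ⟨hk, le_rfl⟩)]
      exact hq.support _ (x _).2 _ hlt
  have hall : ∀ᵐ ω ∂P, ∀ (k : ℕ) (hk : 1 ≤ k) (x : Finset.Icc 1 k → I) (y : Finset.Icc 1 k → ℕ),
      (x ⟨k, Finset.mem_Icc.2 ⟨hk, le_rfl⟩⟩ : ℤ).natAbs <
        y ⟨k, Finset.mem_Icc.2 ⟨hk, le_rfl⟩⟩ →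
        ω ∈ jumpsEvent S k (fun j => x j) → ¬ ∀ j : Finset.Icc 1 k, Y j ω = y j := by
    rw [ae_all_iff]
    intro k
    rw [ae_all_iff]
    intro hk
    rw [ae_all_iff]
    intro x
    rw [ae_all_iff]
    exact hnull k hk x
  filter_upwards [hall, hpath] with ω h1 h2 k hk t ht
  rw [h2.jumpCount_eq] at ht
  by_contra hlt
  refine h1 k hk (fun j => ⟨jumpSize (path S ω) j, h2.jumpSize_mem (Finset.mem_Icc.1 j.2).1
    ((Finset.mem_Icc.1 j.2).2.trans ht)⟩) (fun j => Y j ω) (not_le.1 hlt) (fun j => ?_)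
    (fun j => rfl)
  exact (h2.jumpSizeIs_iff (Finset.mem_Icc.1 j.2).1 ((Finset.mem_Icc.1 j.2).2.trans ht) _).2 rfl

/-- The bound on the marks leaves finitely many mark vectors; summing over them and factoring the
sum expresses the conditional independence. -/
lemma setIntegral_prod_marks {P : Measure Ω} [IsProbabilityMeasure P] {q : ℕ → ℤ → ℝ}
    {S : ℝ≥0 → Ω → ℤ} {Y : ℕ → Ω → ℕ} (hS : ∀ t, Measurable (S t)) (hY : IsSplitting q S Y P)
    {A : Set Ω} (hA : MeasurableSet[MeasurableSpace.comap (path S) MeasurableSpace.pi] A) {n D : ℕ}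
    {x : ℕ → ℤ} (hx : ∀ᵐ ω ∂P, ω ∈ A → (∃ t, n ≤ jumpCount (path S ω) t) ∧
      ∀ k ∈ Finset.Icc 1 n, jumpSize (path S ω) k = x k)
    (hD : ∀ᵐ ω ∂P, ω ∈ A → ∀ k ∈ Finset.Icc 1 n, Y k ω < D) (h : ℕ → ℕ → ℂ) :
    ∫ ω in A, ∏ k ∈ Finset.Icc 1 n, h k (Y k ω) ∂P =
      (P.real A : ℂ) * ∏ k ∈ Finset.Icc 1 n, ∑ y ∈ Finset.range D, (q y (x k) : ℂ) * h k y := by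
  classical
  have hm := comap_path_le hS
  have hB : ∀ y : Finset.Icc 1 n → Fin D,
      MeasurableSet {ω | ∀ k : Finset.Icc 1 n, Y k ω = y k} := by
    intro y
    simp only [Set.ofPred_forall]
    exact MeasurableSet.iInter fun k => measurableSet_eq_fun (hY.measurable k) measurable_const
  have hexp : ∫ ω in A, ∏ k ∈ Finset.Icc 1 n, h k (Y k ω) ∂P =
      ∫ ω in A, ∑ y : Finset.Icc 1 n → Fin D,
        Set.indicator {ω | ∀ k : Finset.Icc 1 n, Y k ω = y k}
          (fun _ => ∏ k : Finset.Icc 1 n, h k (y k)) ω ∂P := by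
    refine setIntegral_congr_ae (hm _ hA) ?_
    filter_upwards [hD] with ω hω hmem
    rw [Fintype.sum_eq_single (fun k : Finset.Icc 1 n => (⟨Y k ω, hω hmem k k.2⟩ : Fin D)),
      Set.indicator_of_mem (by simp)]
    · exact (Finset.prod_coe_sort (Finset.Icc 1 n) (fun k => h k (Y k ω))).symm
    · intro y hy
      refine Set.indicator_of_notMem (fun hmem => hy (funext fun k => Fin.ext ?_)) _
      exact (hmem k).symm
  rw [hexp, integral_finsetSum _ fun y _ => (integrable_const _).indicator (hB y)]
  have hterm : ∀ y : Finset.Icc 1 n → Fin D,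
      ∫ ω in A, Set.indicator {ω | ∀ k : Finset.Icc 1 n, Y k ω = y k}
          (fun _ => ∏ k : Finset.Icc 1 n, h k (y k)) ω ∂P =
        (P.real A : ℂ) * ∏ k : Finset.Icc 1 n, ((q (y k) (x k) : ℂ) * h k (y k)) := by
    intro y
    have hval : ∀ k (hk : k ∈ Finset.Icc 1 n),
        Function.extend Subtype.val (fun k => (y k : ℕ)) 0 k = y ⟨k, hk⟩ := fun k hk =>
      Subtype.val_injective.extend_apply (fun k => (y k : ℕ)) 0 ⟨k, hk⟩
    have h1 := measureReal_inter_marks_eq hS hY hA hx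
      (Function.extend Subtype.val (fun k => (y k : ℕ)) 0)
    have hset : {ω | ∀ k ∈ Finset.Icc 1 n,
        Y k ω = Function.extend Subtype.val (fun k => (y k : ℕ)) 0 k} =
        {ω | ∀ k : Finset.Icc 1 n, Y k ω = y k} := by
      ext ω
      simp only [Set.mem_ofPred_eq]
      constructor
      · intro hω k
        rw [hω k k.2, hval k k.2]
      · intro hω k hk
        rw [hval k hk]
        exact hω ⟨k, hk⟩
    rw [hset] at h1
    rw [setIntegral_indicator (hB y), setIntegral_const, h1,
      ← Finset.prod_coe_sort (Finset.Icc 1 n), Finset.prod_mul_distrib, Complex.real_smul]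
    push_cast
    rw [mul_assoc]
    congr 2
    exact Finset.prod_congr rfl fun k _ => by rw [hval k k.2]
  simp_rw [hterm]
  rw [← Finset.mul_sum, ← Finset.prod_coe_sort (Finset.Icc 1 n)]
  congr 1
  simp_rw [Finset.sum_range]
  rw [Finset.prod_univ_sum, Fintype.piFinset_univ]

/-! ### Counting the jumps with a given size and mark -/

open Classical in
/-- The number of jumps of size `i` with mark `y` in `[0, t]`, set to `0` off the event `G`. -/
def markCount (G : Set Ω) (I : Finset ℤ) (N : ℤ → ℝ≥0 → Ω → ℕ) (S : ℝ≥0 → Ω → ℤ)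
    (Y : ℕ → Ω → ℕ) (i : ℤ) (y : ℕ) (t : ℝ≥0) : Ω → ℕ :=
  G.indicator fun ω => ((Finset.Icc 1 (total I (fun i t => N i t ω) t)).filter fun k =>
    JumpSizeIs k i (path S ω) ∧ Y k ω = y).card

/-- A measurable event on which all paths are Skellam paths and the marks of the jumps `x` are at
most `|x|`. -/
structure IsGoodEvent (G : Set Ω) (I : Finset ℤ) (N : ℤ → ℝ≥0 → Ω → ℕ) (S : ℝ≥0 → Ω → ℤ)
    (Y : ℕ → Ω → ℕ) (P : Measure Ω) : Prop where
  measurableSet : MeasurableSet G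
  ae_mem : ∀ᵐ ω ∂P, ω ∈ G
  isSkellamPath : ∀ ω ∈ G, IsSkellamPath I (fun i t => N i t ω) (path S ω)
  mark_le : ∀ ω ∈ G, ∀ k, 1 ≤ k → ∀ t, k ≤ total I (fun i t => N i t ω) t →
    Y k ω ≤ (jumpSize (path S ω) k).natAbs

/-- The almost sure properties need not define a measurable set; the complement of a measurable null
set containing their failures does. -/
lemma exists_isGoodEvent {P : Measure Ω} [IsProbabilityMeasure P] {I : Finset ℤ} {q : ℕ → ℤ → ℝ}
    {S : ℝ≥0 → Ω → ℤ} {Y : ℕ → Ω → ℕ} {N : ℤ → ℝ≥0 → Ω → ℕ} (hS : ∀ t, Measurable (S t))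
    (hq : IsSplitRule I q) (hY : IsSplitting q S Y P)
    (hpath : ∀ᵐ ω ∂P, IsSkellamPath I (fun i t => N i t ω) (path S ω)) :
    ∃ G, IsGoodEvent G I N S Y P := by
  obtain ⟨Z, hsub, hZm, hZ⟩ := exists_measurable_superset_of_null
    (hpath.and (ae_mark_le_natAbs hS hq hY hpath))
  have hgood : ∀ ω ∈ Zᶜ, _ := fun ω hω => not_not.1 fun hcon => hω (hsub hcon)
  refine ⟨Zᶜ, hZm.compl, measure_eq_zero_iff_ae_notMem.1 hZ, fun ω hω => (hgood ω hω).1,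
    fun ω hω k hk t ht => (hgood ω hω).2 k hk t ?_⟩
  rwa [(hgood ω hω).1.jumpCount_eq]

section

variable {P : Measure Ω} {I : Finset ℤ} {S : ℝ≥0 → Ω → ℤ} {Y : ℕ → Ω → ℕ}
  {N : ℤ → ℝ≥0 → Ω → ℕ} {G : Set Ω}

open Classical in
lemma measurable_markCount (hS : ∀ t, Measurable (S t)) (hY : ∀ k, Measurable (Y k))
    (hN : ∀ i ∈ I, ∀ t, Measurable (N i t)) (hG : MeasurableSet G) (i : ℤ) (y : ℕ) (t : ℝ≥0) :
    Measurable (markCount G I N S Y i y t) := by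
  refine Measurable.indicator ?_ hG
  have hpath : Measurable (path S) := measurable_pi_lambda _ hS
  have h1 : Measurable (fun ω => total I (fun i t => N i t ω) t) :=
    Finset.measurable_sum _ fun i hi => hN i hi t
  have h2 : ∀ n : ℕ, Measurable (fun ω => ((Finset.Icc 1 n).filter fun k =>
      JumpSizeIs k i (path S ω) ∧ Y k ω = y).card) := by
    intro n
    simp_rw [Finset.card_filter]
    refine Finset.measurable_sum _ fun k _ => Measurable.ite ?_ measurable_const measurable_const
    exact (hpath (measurableSet_jumpSizeIs k i)).inter
      (measurableSet_eq_fun (hY k) measurable_const)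
  -- The range of summation is random: it is fixed first, and the random total is inserted
  -- afterwards.
  have h3 : Measurable (fun p : ℕ × Ω => ((Finset.Icc 1 p.1).filter fun k =>
      JumpSizeIs k i (path S p.2) ∧ Y k p.2 = y).card) := measurable_from_prod_countable_right h2
  exact h3.comp (h1.prodMk measurable_id)

lemma IsGoodEvent.markCount_eq (hG : IsGoodEvent G I N S Y P) {ω : Ω} (hω : ω ∈ G) (i : ℤ) (y : ℕ)
    (t : ℝ≥0) : markCount G I N S Y i y t ω =
      ((Finset.Icc 1 (total I (fun i t => N i t ω) t)).filter fun k =>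
        jumpSize (path S ω) k = i ∧ Y k ω = y).card := by
  classical
  rw [markCount, Set.indicator_of_mem hω]
  congr 1
  refine Finset.filter_congr fun k hk => ?_
  rw [(hG.isSkellamPath ω hω).jumpSizeIs_iff (Finset.mem_Icc.1 hk).1 (Finset.mem_Icc.1 hk).2]

lemma IsGoodEvent.markCount_sub (hG : IsGoodEvent G I N S Y P) {ω : Ω} (hω : ω ∈ G) (i : ℤ)
    (y : ℕ) {s t : ℝ≥0} (hst : s ≤ t) :
    markCount G I N S Y i y t ω - markCount G I N S Y i y s ω =
      ((Finset.Ioc (total I (fun i t => N i t ω) s) (total I (fun i t => N i t ω) t)).filter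
        fun k => jumpSize (path S ω) k = i ∧ Y k ω = y).card := by
  have hle := (hG.isSkellamPath ω hω).total_mono hst
  rw [hG.markCount_eq hω, hG.markCount_eq hω, ← Finset.card_sdiff_of_subset]
  · congr 1
    ext k
    simp only [Finset.mem_filter, Finset.mem_Ioc, Finset.mem_sdiff, Finset.mem_Icc]
    constructor
    · rintro ⟨⟨⟨h1, h2⟩, h3⟩, h4⟩
      refine ⟨⟨?_, h2⟩, h3⟩
      by_contra h5
      exact h4 ⟨⟨h1, by omega⟩, h3⟩
    · rintro ⟨⟨h1, h2⟩, h3⟩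
      exact ⟨⟨⟨by omega, h2⟩, h3⟩, fun h4 => by omega⟩
  · intro k
    simp only [Finset.mem_filter, Finset.mem_Icc]
    rintro ⟨⟨h1, h2⟩, h3⟩
    exact ⟨⟨h1, h2.trans hle⟩, h3⟩

lemma IsGoodEvent.isCounting_markCount (hG : IsGoodEvent G I N S Y P)
    (hS : ∀ t, Measurable (S t)) (hY : ∀ k, Measurable (Y k))
    (hN : ∀ i ∈ I, ∀ t, Measurable (N i t)) (i : ℤ) (y : ℕ) :
    IsCounting (markCount G I N S Y i y) P where
  measurable := measurable_markCount hS hY hN hG.measurableSet i y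
  path := by
    filter_upwards [hG.ae_mem] with ω hω
    have h := hG.isSkellamPath ω hω
    simp_rw [hG.markCount_eq hω]
    refine ⟨by simp [h.total_zero], fun s t hst => ?_, fun t => ?_⟩
    · exact Finset.card_le_card (Finset.filter_subset_filter _
        (Finset.Icc_subset_Icc_right (h.total_mono hst)))
    · obtain ⟨u, hu, hs⟩ := h.exists_total_eq_right t
      rw [ContinuousWithinAt, nhds_discrete, Filter.tendsto_pure]
      filter_upwards [Ico_mem_nhdsGE hu] with s hs'
      rw [hs s hs']

end

/-- If every `k ∈ s` has exactly one colour `c`, and `g k = F c`, then grouping the factors `g k`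
by colours yields powers of the `F c`. -/
lemma prod_pow_card_filter {C : Type*} [Fintype C] (s : Finset ℕ) (p : C → ℕ → Prop)
    [∀ c, DecidablePred (p c)] (F : C → ℂ) (g : ℕ → ℂ)
    (h : ∀ k ∈ s, ∃ c, p c k ∧ g k = F c ∧ ∀ c', p c' k → c' = c) :
    ∏ c, F c ^ (s.filter (p c)).card = ∏ k ∈ s, g k := by
  simp_rw [← Finset.prod_const, Finset.prod_filter]
  rw [Finset.prod_comm]
  refine Finset.prod_congr rfl fun k hk => ?_
  obtain ⟨c, hc, hg, huniq⟩ := h k hk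
  rw [Fintype.prod_eq_single c fun c' hc' => if_neg fun hp => hc' (huniq c' hp), if_pos hc, hg]

/-- This turns a product over grid cells into one product over jumps, the form in which
`setIntegral_prod_marks` integrates. -/
lemma prod_Ioc_eq_prod_Icc {m : ℕ} {ν : Fin (m + 1) → ℕ} (hν : Monotone ν)
    (F : Fin m → ℕ → ℂ) :
    ∏ l : Fin m, ∏ k ∈ Finset.Ioc (ν l.castSucc) (ν l.succ), F l k =
      ∏ k ∈ Finset.Icc 1 (ν (Fin.last m)), ∏ l : Fin m,
        if k ∈ Finset.Ioc (ν l.castSucc) (ν l.succ) then F l k else 1 := by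
  rw [Finset.prod_comm]
  refine Finset.prod_congr rfl fun l _ => ?_
  rw [← Finset.prod_filter]
  refine Finset.prod_congr ?_ fun _ _ => rfl
  ext k
  have := hν (Fin.le_last l.succ)
  simp only [Finset.mem_filter, Finset.mem_Icc, Finset.mem_Ioc]
  omega

/-- A convex combination of products with at most one factor different from `1`. -/
lemma sum_mul_prod_ite {m : ℕ} {ν : Fin (m + 1) → ℕ} (hν : Monotone ν) (k D : ℕ) (w : ℕ → ℂ)
    (hw : ∑ y ∈ Finset.range D, w y = 1) (F : Fin m → ℕ → ℂ) :
    ∑ y ∈ Finset.range D, w y * ∏ l : Fin m,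
        (if k ∈ Finset.Ioc (ν l.castSucc) (ν l.succ) then F l y else 1) =
      ∏ l : Fin m, if k ∈ Finset.Ioc (ν l.castSucc) (ν l.succ) then
        ∑ y ∈ Finset.range D, w y * F l y else 1 := by
  by_cases hex : ∃ l : Fin m, k ∈ Finset.Ioc (ν l.castSucc) (ν l.succ)
  · obtain ⟨l, hl⟩ := hex
    have huniq : ∀ l' : Fin m, l' ≠ l → k ∉ Finset.Ioc (ν l'.castSucc) (ν l'.succ) := by
      intro l' hne hl'
      rw [Finset.mem_Ioc] at hl hl'
      rcases lt_or_gt_of_ne hne with hlt | hlt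
      · have := hν (show l'.succ ≤ l.castSucc from hlt)
        omega
      · have := hν (show l.succ ≤ l'.castSucc from hlt)
        omega
    rw [Fintype.prod_eq_single l fun l' hne => if_neg (huniq l' hne), if_pos hl]
    refine Finset.sum_congr rfl fun y _ => ?_
    rw [Fintype.prod_eq_single l fun l' hne => if_neg (huniq l' hne), if_pos hl]
  -- When `k` lies in no cell all factors are `1`, and only the total weight `hw` remains.
  · rw [not_exists] at hex
    simp [hex, hw]

lemma IsSplitRule.sum_range_eq {I : Finset ℤ} {q : ℕ → ℤ → ℝ} (hq : IsSplitRule I q) {i : ℤ}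
    (hi : i ∈ I) {D : ℕ} (hD : i.natAbs < D) (g : ℕ → ℝ) :
    ∑ y ∈ Finset.range D, g y * q y i = ∑ y ∈ Finset.range (i.natAbs + 1), g y * q y i := by
  symm
  refine Finset.sum_subset (Finset.range_subset_range.2 hD) fun y _ hy => ?_
  rw [hq.support i hi y (by simpa using hy), mul_zero]

lemma IsSplitRule.sum_range_eq_one {I : Finset ℤ} {q : ℕ → ℤ → ℝ} (hq : IsSplitRule I q) {i : ℤ}
    (hi : i ∈ I) {D : ℕ} (hD : i.natAbs < D) : ∑ y ∈ Finset.range D, q y i = 1 := by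
  have := hq.sum_range_eq hi hD fun _ => 1
  simpa [hq.sum_eq_one i hi] using this

lemma IsRate.mul_const {r : ℝ → ℝ} (hr : IsRate r) {c : ℝ} (hc : 0 ≤ c) :
    IsRate (fun u => r u * c) :=
  ⟨fun u hu => mul_nonneg (hr.1 u hu) hc, fun t ht => (hr.2 t ht).mul_const c⟩

lemma cumRate_mul_const (r : ℝ → ℝ) (c : ℝ) (s t : ℝ≥0) :
    cumRate (fun u => r u * c) s t = cumRate r s t * c :=
  intervalIntegral.integral_mul_const _ _

/-- Two integrable functions with the same integral over each part of a countable partition. -/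
lemma integral_eq_of_setIntegral_eq {J : Type*} [Countable J] {P : Measure Ω} {A : J → Set Ω}
    (hA : ∀ j, MeasurableSet (A j)) (hdisj : Pairwise fun j j' => AEDisjoint P (A j) (A j'))
    (hcover : ∀ᵐ ω ∂P, ∃ j, ω ∈ A j) {f g : Ω → ℂ} (hf : Integrable f P) (hg : Integrable g P)
    (h : ∀ j, ∫ ω in A j, f ω ∂P = ∫ ω in A j, g ω ∂P) : ∫ ω, f ω ∂P = ∫ ω, g ω ∂P := by
  have hU : (⋃ j, A j) =ᵐ[P] Set.univ := by
    rw [Filter.eventuallyEq_univ]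
    filter_upwards [hcover] with ω hω
    simpa using hω
  rw [← setIntegral_univ (f := f), ← setIntegral_univ (f := g), ← setIntegral_congr_set hU,
    ← setIntegral_congr_set hU,
    integral_iUnion_ae (fun j => (hA j).nullMeasurableSet) hdisj hf.integrableOn,
    integral_iUnion_ae (fun j => (hA j).nullMeasurableSet) hdisj hg.integrableOn]
  exact tsum_congr h

/-! ### The marking theorem -/

/-- The event that there are exactly `ν l` jumps in `[0, t l]` for every `l ≤ m` and that the jumps
up to `t m` are given by `x`. -/
def configEvent {Ω : Type*} (S : ℝ≥0 → Ω → ℤ) (t : ℕ → ℝ≥0) {m : ℕ} (ν : Fin (m + 1) → ℕ)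
    (x : Finset.Icc 1 (ν (Fin.last m)) → ℤ) : Set Ω :=
  {ω | ∀ l : Fin (m + 1), AtLeastJumps (ν l) (t l) (path S ω) ∧
    ¬ AtLeastJumps (ν l + 1) (t l) (path S ω)} ∩ jumpsEvent S (ν (Fin.last m)) x

lemma measurableSet_configEvent {Ω : Type*} (S : ℝ≥0 → Ω → ℤ) (t : ℕ → ℝ≥0) {m : ℕ}
    (ν : Fin (m + 1) → ℕ) (x : Finset.Icc 1 (ν (Fin.last m)) → ℤ) :
    MeasurableSet[MeasurableSpace.comap (path S) MeasurableSpace.pi] (configEvent S t ν x) := by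
  refine MeasurableSet.inter ?_ (measurableSet_jumpsEvent S _ x)
  refine ⟨⋂ l : Fin (m + 1), {f | AtLeastJumps (ν l) (t l) f} ∩
      {f | AtLeastJumps (ν l + 1) (t l) f}ᶜ,
    MeasurableSet.iInter fun l => (measurableSet_atLeastJumps _ _).inter
      (measurableSet_atLeastJumps _ _).compl, ?_⟩
  ext ω
  simp

lemma IsSkellamPath.mem_configEvent_iff {Ω : Type*} {I : Finset ℤ} {n : ℤ → ℝ≥0 → ℕ}
    {S : ℝ≥0 → Ω → ℤ} {ω : Ω} (h : IsSkellamPath I n (path S ω)) {t : ℕ → ℝ≥0} {m : ℕ} {ν : Fin (m + 1) → ℕ}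
    {x : Finset.Icc 1 (ν (Fin.last m)) → ℤ} :
    ω ∈ configEvent S t ν x ↔ (∀ l : Fin (m + 1), total I n (t l) = ν l) ∧
      ∀ k : Finset.Icc 1 (ν (Fin.last m)), jumpSize (path S ω) k = x k := by
  simp only [configEvent, jumpsEvent, Set.mem_inter_iff, Set.mem_ofPred_eq, h.atLeastJumps_iff]
  have h1 : (∀ l : Fin (m + 1), ν l ≤ total I n (t l) ∧ ¬ ν l + 1 ≤ total I n (t l)) ↔
      ∀ l : Fin (m + 1), total I n (t l) = ν l :=
    forall_congr' fun l => by omega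
  rw [h1]
  refine and_congr_right fun hν => forall_congr' fun k => ?_
  exact h.jumpSizeIs_iff (t := t (Fin.last m)) (Finset.mem_Icc.1 k.2).1
    ((Finset.mem_Icc.1 k.2).2.trans (hν _).ge) _

section

variable {P : Measure Ω} [IsProbabilityMeasure P] {I : Finset ℤ} {q : ℕ → ℤ → ℝ}
  {S : ℝ≥0 → Ω → ℤ} {Y : ℕ → Ω → ℕ} {N : ℤ → ℝ≥0 → Ω → ℕ} {G : Set Ω}

/-- Extension of a function of colours by `1`. -/
def colourExtend {D : ℕ} (z : I × Fin D → ℕ → ℂ) (i : ℤ) (y l : ℕ) : ℂ :=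
  if h : i ∈ I ∧ y < D then z (⟨i, h.1⟩, ⟨y, h.2⟩) l else 1

/-- On a configuration both integrands become products over the jumps: on the left of the variable
chosen by the random mark, on the right of its average under `q`. Conditional independence of the
marks equates the integrals. -/
lemma setIntegral_markCount_eq (hS : ∀ t, Measurable (S t)) (hq : IsSplitRule I q)
    (hY : IsSplitting q S Y P) (hG : IsGoodEvent G I N S Y P) {D : ℕ}
    (hD : ∀ i ∈ I, i.natAbs < D) {t : ℕ → ℝ≥0} (ht : Monotone t) {m : ℕ}
    (z : I × Fin D → ℕ → ℂ) (ν : Fin (m + 1) → ℕ) (x : Finset.Icc 1 (ν (Fin.last m)) → I) :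
    ∫ ω in configEvent S t ν (fun k => x k), ∏ c : I × Fin D, ∏ l ∈ Finset.range m,
        z c l ^ (markCount G I N S Y c.1 c.2 (t (l + 1)) ω -
          markCount G I N S Y c.1 c.2 (t l) ω) ∂P =
      ∫ ω in configEvent S t ν (fun k => x k), ∏ i : I, ∏ l ∈ Finset.range m,
        (∑ y ∈ Finset.range D, (q y i : ℂ) * colourExtend z i y l) ^
          (N i (t (l + 1)) ω - N i (t l) ω) ∂P := by
  classical
  set A := configEvent S t ν (fun k => (x k : ℤ))
  have hAm := measurableSet_configEvent S t ν (fun k => (x k : ℤ))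
  have hm := comap_path_le hS
  have hA : ∀ ω ∈ G, ω ∈ A → (∀ l : Fin (m + 1), total I (fun i t => N i t ω) (t l) = ν l) ∧
      ∀ k : Finset.Icc 1 (ν (Fin.last m)), jumpSize (path S ω) k = x k := fun ω hω hmem =>
    (hG.isSkellamPath ω hω).mem_configEvent_iff.1 hmem
  -- `ν` is arbitrary, so its monotonicity can only be read off from a point of the event.
  have hν : ∀ ω ∈ G, ω ∈ A → Monotone ν := fun ω hω hmem l l' hll' => by
    rw [← (hA ω hω hmem).1, ← (hA ω hω hmem).1]
    exact (hG.isSkellamPath ω hω).total_mono (ht hll')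
  set X : ℕ → ℤ := Function.extend Subtype.val (fun k => (x k : ℤ)) 0
  have hXval : ∀ k (hk : k ∈ Finset.Icc 1 (ν (Fin.last m))), X k = x ⟨k, hk⟩ := fun k hk =>
    Subtype.val_injective.extend_apply (fun k => (x k : ℤ)) 0 ⟨k, hk⟩
  have hsize : ∀ ω ∈ G, ω ∈ A → ∀ k ∈ Finset.Icc 1 (ν (Fin.last m)),
      jumpSize (path S ω) k = X k := fun ω hω hmem k hk => by
    rw [hXval k hk, (hA ω hω hmem).2 ⟨k, hk⟩]
  have hXI : ∀ k ∈ Finset.Icc 1 (ν (Fin.last m)), X k ∈ I := fun k hk => by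
    rw [hXval k hk]
    exact (x _).2
  have hYD : ∀ ω ∈ G, ω ∈ A → ∀ k ∈ Finset.Icc 1 (ν (Fin.last m)), Y k ω < D := by
    intro ω hω hmem k hk
    refine (hG.mark_le ω hω k (Finset.mem_Icc.1 hk).1 (t (Fin.last m)) ?_).trans_lt ?_
    · rw [(hA ω hω hmem).1]
      exact (Finset.mem_Icc.1 hk).2
    · rw [hsize ω hω hmem k hk]
      exact hD _ (hXI k hk)
  have hIoc : Monotone ν → ∀ l : Fin m, ∀ k ∈ Finset.Ioc (ν l.castSucc) (ν l.succ),
      k ∈ Finset.Icc 1 (ν (Fin.last m)) := by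
    intro hmono l k hk
    have := hmono (Fin.le_last l.succ)
    rw [Finset.mem_Ioc] at hk
    rw [Finset.mem_Icc]
    omega
  set h : ℕ → ℕ → ℂ := fun k y => ∏ l : Fin m,
    if k ∈ Finset.Ioc (ν l.castSucc) (ν l.succ) then colourExtend z (X k) y l else 1 with hh
  have hlhs : ∀ ω ∈ G, ω ∈ A → ∏ c : I × Fin D, ∏ l ∈ Finset.range m,
        z c l ^ (markCount G I N S Y c.1 c.2 (t (l + 1)) ω -
          markCount G I N S Y c.1 c.2 (t l) ω) =
      ∏ k ∈ Finset.Icc 1 (ν (Fin.last m)), h k (Y k ω) := by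
    intro ω hω hmem
    have hmono := hν ω hω hmem
    simp_rw [Finset.prod_range, hh]
    rw [Finset.prod_comm,
      ← prod_Ioc_eq_prod_Icc hmono (fun l k => colourExtend z (X k) (Y k ω) l)]
    refine Finset.prod_congr rfl fun l _ => ?_
    have h1 := (hA ω hω hmem).1 l.castSucc
    have h2 := (hA ω hω hmem).1 l.succ
    simp only [Fin.val_castSucc, Fin.val_succ] at h1 h2
    simp_rw [hG.markCount_sub hω _ _ (ht (Nat.le_succ l)), Nat.succ_eq_add_one, h1, h2]
    refine prod_pow_card_filter _
      (fun (c : I × Fin D) k => jumpSize (path S ω) k = c.1 ∧ Y k ω = c.2) (fun c => z c l) _ ?_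
    intro k hk
    have hk' := hIoc hmono l k hk
    refine ⟨(⟨X k, hXI k hk'⟩, ⟨Y k ω, hYD ω hω hmem k hk'⟩), ⟨hsize ω hω hmem k hk', rfl⟩, ?_, ?_⟩
    · rw [colourExtend, dif_pos ⟨hXI k hk', hYD ω hω hmem k hk'⟩]
    · rintro ⟨c, d⟩ ⟨h3, h4⟩
      refine Prod.ext (Subtype.ext ?_) (Fin.ext h4.symm)
      exact h3.symm.trans (hsize ω hω hmem k hk')
  have hrhs : ∀ ω ∈ G, ω ∈ A → ∏ i : I, ∏ l ∈ Finset.range m,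
        (∑ y ∈ Finset.range D, (q y i : ℂ) * colourExtend z i y l) ^
          (N i (t (l + 1)) ω - N i (t l) ω) =
      ∏ k ∈ Finset.Icc 1 (ν (Fin.last m)), ∑ y ∈ Finset.range D, (q y (X k) : ℂ) * h k y := by
    intro ω hω hmem
    have hmono := hν ω hω hmem
    have hpath := hG.isSkellamPath ω hω
    have hsum : ∀ k ∈ Finset.Icc 1 (ν (Fin.last m)),
        ∑ y ∈ Finset.range D, (q y (X k) : ℂ) * h k y = ∏ l : Fin m,
          if k ∈ Finset.Ioc (ν l.castSucc) (ν l.succ) then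
            ∑ y ∈ Finset.range D, (q y (X k) : ℂ) * colourExtend z (X k) y l else 1 := by
      intro k hk
      refine sum_mul_prod_ite hmono k D (fun y => (q y (X k) : ℂ)) ?_
        (fun l y => colourExtend z (X k) y l)
      exact_mod_cast hq.sum_range_eq_one (hXI k hk) (hD _ (hXI k hk))
    rw [Finset.prod_congr rfl hsum]
    simp_rw [Finset.prod_range]
    rw [Finset.prod_comm, ← prod_Ioc_eq_prod_Icc hmono (fun l k =>
      ∑ y ∈ Finset.range D, (q y (X k) : ℂ) * colourExtend z (X k) y l)]
    refine Finset.prod_congr rfl fun l _ => ?_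
    have h1 := (hA ω hω hmem).1 l.castSucc
    have h2 := (hA ω hω hmem).1 l.succ
    simp only [Fin.val_castSucc, Fin.val_succ] at h1 h2
    have h3 : ∀ i : I, N i (t (l + 1)) ω - N i (t l) ω =
        ((Finset.Ioc (ν l.castSucc) (ν l.succ)).filter
          fun k => jumpSize (path S ω) k = i).card := fun i => by
      rw [← hpath.card_jumpSize_Ioc i.2 (ht (Nat.le_succ l)), Nat.succ_eq_add_one, h1, h2]
    simp_rw [h3]
    refine prod_pow_card_filter _ (fun (i : I) k => jumpSize (path S ω) k = i)
      (fun i => ∑ y ∈ Finset.range D, (q y i : ℂ) * colourExtend z i y l) _ ?_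
    intro k hk
    have hk' := hIoc hmono l k hk
    refine ⟨⟨X k, hXI k hk'⟩, hsize ω hω hmem k hk', rfl, fun c hc => Subtype.ext ?_⟩
    exact hc.symm.trans (hsize ω hω hmem k hk')
  rw [setIntegral_congr_ae (hm _ hAm) (hG.ae_mem.mono hlhs),
    setIntegral_congr_ae (hm _ hAm) (hG.ae_mem.mono hrhs), setIntegral_const, Complex.real_smul]
  refine setIntegral_prod_marks hS hY hAm ?_ (hG.ae_mem.mono hYD) h
  filter_upwards [hG.ae_mem] with ω hω hmem
  refine ⟨⟨t (Fin.last m), ?_⟩, hsize ω hω hmem⟩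
  rw [(hG.isSkellamPath ω hω).jumpCount_eq, (hA ω hω hmem).1]

lemma integrable_prod_pow {C : Type*} [Fintype C] {M : C → ℝ≥0 → Ω → ℕ}
    (hM : ∀ c t, Measurable (M c t)) (t : ℕ → ℝ≥0) (m : ℕ) {z : C → ℕ → ℂ}
    (hz : ∀ c l, ‖z c l‖ ≤ 1) :
    Integrable (fun ω => ∏ c, ∏ l ∈ Finset.range m,
      z c l ^ (M c (t (l + 1)) ω - M c (t l) ω)) P := by
  refine Integrable.of_bound (C := 1) (Measurable.aestronglyMeasurable ?_)
    (Filter.Eventually.of_forall fun ω => ?_)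
  · refine Finset.measurable_prod _ fun c _ => Finset.measurable_prod _ fun l _ => ?_
    exact (Measurable.of_discrete (f := fun n : ℕ => z c l ^ n)).comp ((hM _ _).sub (hM _ _))
  · simp_rw [norm_prod, norm_pow]
    exact Finset.prod_le_one (fun c _ => Finset.prod_nonneg fun l _ => by positivity) fun c _ =>
      Finset.prod_le_one (fun l _ => by positivity) fun l _ => pow_le_one₀ (norm_nonneg _) (hz c l)

/-- The marking theorem. Summing over configurations trades the coloured counts for the `N i` with
averaged variables `φ`; the exponent is linear in `φ`, and the total mass of `q` being one splits it
over the marks. -/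
lemma hasPoissonIncrements_markCount {lam : ℤ → ℝ → ℝ} (hS : ∀ t, Measurable (S t))
    (hq : IsSplitRule I q) (hY : IsSplitting q S Y P)
    (hN : ∀ i ∈ I, ∀ t, Measurable (N i t)) (hG : IsGoodEvent G I N S Y P)
    (hP : HasPoissonIncrements (fun i : I => N i) (fun i : I => lam i) P) {D : ℕ}
    (hD : ∀ i ∈ I, i.natAbs < D) :
    HasPoissonIncrements (fun c : I × Fin D => markCount G I N S Y c.1 c.2)
      (fun c u => lam c.1 u * q c.2 c.1) P := by
  intro t ht m z hz
  set φ : I → ℕ → ℂ := fun i l => ∑ y ∈ Finset.range D, (q y i : ℂ) * colourExtend z i y l with hφ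
  have hext : ∀ (i : ℤ) (y l : ℕ), ‖colourExtend z i y l‖ ≤ 1 := by
    intro i y l
    unfold colourExtend
    split_ifs
    · exact hz _ _
    · simp
  -- A convex combination of points of the unit disc stays in it, as `hP` requires.
  have hφ1 : ∀ i l, ‖φ i l‖ ≤ 1 := by
    intro i l
    rw [← hq.sum_range_eq_one i.2 (hD i i.2)]
    refine (norm_sum_le _ _).trans (Finset.sum_le_sum fun y _ => ?_)
    rw [norm_mul, Complex.norm_real, Real.norm_of_nonneg (hq.nonneg i i.2 y)]
    exact mul_le_of_le_one_right (hq.nonneg i i.2 y) (hext _ _ _)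
  have hintM := integrable_prod_pow (P := P)
    (M := fun c : I × Fin D => markCount G I N S Y c.1 c.2)
    (fun c t => measurable_markCount hS hY.measurable hN hG.measurableSet c.1 c.2 t) t m hz
  have hintN := integrable_prod_pow (P := P) (M := fun i : I => N i) (fun i t => hN i i.2 t) t m hφ1
  have hint : ∫ ω, ∏ c : I × Fin D, ∏ l ∈ Finset.range m,
        z c l ^ (markCount G I N S Y c.1 c.2 (t (l + 1)) ω -
          markCount G I N S Y c.1 c.2 (t l) ω) ∂P =
      ∫ ω, ∏ i : I, ∏ l ∈ Finset.range m, φ i l ^ (N i (t (l + 1)) ω - N i (t l) ω) ∂P := by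
    refine integral_eq_of_setIntegral_eq
      (J := (ν : Fin (m + 1) → ℕ) × (Finset.Icc 1 (ν (Fin.last m)) → I))
      (A := fun j => configEvent S t j.1 fun k => (j.2 k : ℤ))
      (fun j => comap_path_le hS _ (measurableSet_configEvent _ _ _ _)) ?_ ?_
      hintM hintN
      (fun j => setIntegral_markCount_eq hS hq hY hG hD ht z j.1 j.2)
    · rintro ⟨ν, x⟩ ⟨ν', x'⟩ hne
      refine measure_eq_zero_iff_ae_notMem.2 ?_
      filter_upwards [hG.ae_mem] with ω hω hmem
      have h1 := (hG.isSkellamPath ω hω).mem_configEvent_iff.1 hmem.1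
      have h2 := (hG.isSkellamPath ω hω).mem_configEvent_iff.1 hmem.2
      have hν : ν = ν' := funext fun l => (h1.1 l).symm.trans (h2.1 l)
      subst hν
      have hx : x = x' := funext fun k => Subtype.ext ((h1.2 k).symm.trans (h2.2 k))
      exact hne (by rw [hx])
    · filter_upwards [hG.ae_mem] with ω hω
      have h := hG.isSkellamPath ω hω
      refine ⟨⟨fun l => total I (fun i t => N i t ω) (t l), fun k =>
        ⟨jumpSize (path S ω) k, h.jumpSize_mem (Finset.mem_Icc.1 k.2).1 (Finset.mem_Icc.1 k.2).2⟩⟩,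
        h.mem_configEvent_iff.2 ⟨fun l => rfl, fun k => rfl⟩⟩
  rw [hint, hP t ht m φ hφ1, Fintype.prod_prod_type]
  refine Finset.prod_congr rfl fun i _ => ?_
  rw [Finset.prod_comm]
  refine Finset.prod_congr rfl fun l _ => ?_
  rw [← Complex.exp_sum]
  congr 1
  have hone : (∑ y ∈ Finset.range D, (q y i : ℂ)) = 1 := by
    exact_mod_cast hq.sum_range_eq_one i.2 (hD i i.2)
  calc (cumRate (lam i) (t l) (t (l + 1)) : ℂ) * (φ i l - 1)
      = cumRate (lam i) (t l) (t (l + 1)) * ∑ y ∈ Finset.range D,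
          ((q y i : ℂ) * (colourExtend z i y l - 1)) := by
        congr 1
        simp_rw [mul_sub, Finset.sum_sub_distrib, mul_one, hone, hφ]
    _ = ∑ y : Fin D, (cumRate (fun u => lam i u * q y i) (t l) (t (l + 1)) : ℂ) *
          (z (i, y) l - 1) := by
        rw [Finset.mul_sum, Finset.sum_range]
        refine Finset.sum_congr rfl fun y _ => ?_
        rw [colourExtend, dif_pos ⟨i.2, y.2⟩, cumRate_mul_const]
        push_cast
        ring

end

/-! ### Functionals of the marked jumps -/

lemma sum_card_filter_mul {C : Type*} [Fintype C] (s : Finset ℕ) (p : C → ℕ → Prop)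
    [∀ c, DecidablePred (p c)] (F : C → ℤ) (g : ℕ → ℤ)
    (h : ∀ k ∈ s, ∃ c, p c k ∧ g k = F c ∧ ∀ c', p c' k → c' = c) :
    ∑ c, F c * ((s.filter (p c)).card : ℤ) = ∑ k ∈ s, g k := by
  simp_rw [Finset.card_filter, Nat.cast_sum, Finset.mul_sum]
  rw [Finset.sum_comm]
  refine Finset.sum_congr rfl fun k hk => ?_
  obtain ⟨c, hc, hg, huniq⟩ := h k hk
  rw [Fintype.sum_eq_single c fun c' hc' => by rw [if_neg fun hp => hc' (huniq c' hp)]; simp,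
    if_pos hc, hg]
  simp

lemma IsCounting.sum {ι : Type*} [Finite ι] {P : Measure Ω} {M : ι → ℝ≥0 → Ω → ℕ}
    (hM : ∀ i, IsCounting (M i) P) (s : Finset ι) :
    IsCounting (fun t ω => ∑ i ∈ s, M i t ω) P where
  measurable := fun t => Finset.measurable_sum _ fun i _ => (hM i).measurable t
  path := by
    filter_upwards [ae_all_iff.2 fun i => (hM i).path] with ω hω
    exact ⟨Finset.sum_eq_zero fun i _ => (hω i).1,
      fun _ _ hst => Finset.sum_le_sum fun i _ => (hω i).2.1 hst,
      fun t => tendsto_finsetSum _ fun i _ => (hω i).2.2 t⟩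

section

variable {P : Measure Ω} {I : Finset ℤ} {q : ℕ → ℤ → ℝ}
  {S : ℝ≥0 → Ω → ℤ} {Y : ℕ → Ω → ℕ} {N : ℤ → ℝ≥0 → Ω → ℕ} {G : Set Ω}

lemma IsGoodEvent.sum_marks_eq (hG : IsGoodEvent G I N S Y P) {D : ℕ}
    (hD : ∀ i ∈ I, i.natAbs < D) (v : ℤ → ℕ → ℤ) {ω : Ω} (hω : ω ∈ G) (t : ℝ≥0) :
    ∑ k ∈ Finset.Icc 1 (jumpCount (path S ω) t), v (jumpSize (path S ω) k) (Y k ω) =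
      ∑ c : I × Fin D, v c.1 c.2 * (markCount G I N S Y c.1 c.2 t ω : ℤ) := by
  have hpath := hG.isSkellamPath ω hω
  simp_rw [hG.markCount_eq hω, hpath.jumpCount_eq]
  symm
  refine sum_card_filter_mul _
    (fun (c : I × Fin D) k => jumpSize (path S ω) k = c.1 ∧ Y k ω = c.2) (fun c => v c.1 c.2) _ ?_
  intro k hk
  rw [Finset.mem_Icc] at hk
  have hmem := hpath.jumpSize_mem hk.1 hk.2
  refine ⟨(⟨_, hmem⟩, ⟨Y k ω, (hG.mark_le ω hω k hk.1 t hk.2).trans_lt (hD _ hmem)⟩),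
    ⟨rfl, rfl⟩, rfl, ?_⟩
  rintro ⟨c, d⟩ ⟨h3, h4⟩
  exact Prod.ext (Subtype.ext h3.symm) (Fin.ext h4.symm)

lemma IsGoodEvent.markCount_eq_zero (hG : IsGoodEvent G I N S Y P) {ω : Ω} (hω : ω ∈ G) {i : ℤ}
    {y : ℕ} (hy : i.natAbs < y) (t : ℝ≥0) : markCount G I N S Y i y t ω = 0 := by
  rw [hG.markCount_eq hω, Finset.card_eq_zero, Finset.filter_eq_empty_iff]
  rintro k hk ⟨rfl, rfl⟩
  rw [Finset.mem_Icc] at hk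
  exact hy.not_ge (hG.mark_le ω hω k hk.1 t hk.2)

/-- The colours are superposed according to the value of `v`; this serves both components. The
restriction `y ≤ i.natAbs` is needed because the common bound `D` allows spurious marks, whose
counts vanish on `G`. -/
lemma isNHGSP_sum_marks [IsProbabilityMeasure P] {lam : ℤ → ℝ → ℝ} (hS : ∀ t, Measurable (S t))
    (hlam : ∀ i ∈ I, IsRate (lam i)) (hq : IsSplitRule I q) (hY : IsSplitting q S Y P)
    (hN : ∀ i ∈ I, ∀ t, Measurable (N i t)) (hG : IsGoodEvent G I N S Y P)
    (hP : HasPoissonIncrements (fun i : I => N i) (fun i : I => lam i) P) {D : ℕ}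
    (hD : ∀ i ∈ I, i.natAbs < D) (v : ℤ → ℕ → ℤ) {J : Finset ℤ} (hJ0 : (0 : ℤ) ∉ J)
    (hvJ : ∀ i ∈ I, ∀ y ≤ i.natAbs, v i y ∈ J ∨ v i y = 0) {r : ℤ → ℝ → ℝ}
    (hr : ∀ j ∈ J, ∀ u, r j u = ∑ i ∈ I, ∑ y ∈ Finset.range D,
      if y ≤ i.natAbs ∧ v i y = j then lam i u * q y i else 0)
    {U : ℝ≥0 → Ω → ℤ} (hU : ∀ t ω, U t ω =
      ∑ k ∈ Finset.Icc 1 (jumpCount (path S ω) t), v (jumpSize (path S ω) k) (Y k ω)) :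
    IsNHGSP J r U P := by
  classical
  have hM : ∀ c : I × Fin D, IsCounting (markCount G I N S Y c.1 c.2) P := fun c =>
    hG.isCounting_markCount hS hY.measurable hN c.1 c.2
  have hMr : ∀ c : I × Fin D, IsRate (fun u => lam c.1 u * q c.2 c.1) := fun c =>
    (hlam c.1 c.1.2).mul_const (hq.nonneg c.1 c.1.2 _)
  have hMP := hasPoissonIncrements_markCount hS hq hY hN hG hP hD
  set K : ℤ → ℝ≥0 → Ω → ℕ := fun j t ω =>
    ∑ c : I × Fin D with (c.2 : ℕ) ≤ (c.1 : ℤ).natAbs ∧ v c.1 c.2 = j,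
      markCount G I N S Y c.1 c.2 t ω with hK
  have hr' : ∀ j ∈ J, r j = fun u =>
      ∑ c : I × Fin D with (c.2 : ℕ) ≤ (c.1 : ℤ).natAbs ∧ v c.1 c.2 = j,
        lam c.1 u * q c.2 c.1 := by
    intro j hj
    funext u
    rw [hr j hj u, Finset.sum_filter, Fintype.sum_prod_type, ← Finset.sum_coe_sort I]
    refine Finset.sum_congr rfl fun i _ => ?_
    rw [Finset.sum_range]
  have hrate : ∀ j ∈ J, IsRate (r j) := fun j hj => by
    rw [hr' j hj]
    exact isRate_sum _ fun c _ => hMr c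
  have hKc : ∀ j, IsCounting (K j) P := fun j => IsCounting.sum hM _
  -- Spurious colours and those with `v = 0`, which do not move the component, are dropped.
  let φ : I × Fin D → Option J := fun c =>
    if h : (c.2 : ℕ) ≤ (c.1 : ℤ).natAbs ∧ v c.1 c.2 ∈ J then some ⟨v c.1 c.2, h.2⟩ else none
  have hφ : ∀ c (j : J), φ c = some j ↔ (c.2 : ℕ) ≤ (c.1 : ℤ).natAbs ∧ v c.1 c.2 = j := by
    intro c j
    simp only [φ]
    split_ifs with h
    · rw [Option.some_inj, Subtype.ext_iff]
      exact ⟨fun h1 => ⟨h.1, h1⟩, fun h1 => h1.2⟩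
    · simp only [false_iff]
      rintro ⟨h1, h2⟩
      exact h ⟨h1, h2 ▸ j.2⟩
  have hKP := hMP.superpose hMr hM φ (N := fun j : J => K j) (r' := fun j : J => r j)
    (fun j t ω => by simp only [hφ, hK]) (fun j u => by simp only [hφ, hr' j j.2])
  refine ⟨hJ0, hrate, K, fun j hj =>
    hKP.isPoissonProcess (fun j => hrate j j.2) (fun j => hKc j) ⟨j, hj⟩,
    hKP.iIndepFun (fun j => hrate j j.2) (fun j => hKc j), ?_⟩
  filter_upwards [hG.ae_mem] with ω hω t
  rw [hU, hG.sum_marks_eq hD v hω]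
  simp only [hK, Nat.cast_sum, Finset.mul_sum, Finset.sum_filter]
  rw [Finset.sum_comm]
  refine Finset.sum_congr rfl fun c _ => ?_
  by_cases hc : (c.2 : ℕ) ≤ (c.1 : ℤ).natAbs
  · rcases hvJ c.1 c.1.2 c.2 hc with hJ | h0
    · rw [Finset.sum_eq_single_of_mem _ hJ]
      · simp [hc]
      · intro j _ hj
        simp [hj.symm]
    · rw [h0, zero_mul]
      refine (Finset.sum_eq_zero fun j hj => ?_).symm
      have : (0 : ℤ) ≠ j := fun h => hJ0 (h ▸ hj)
      simp [this]
  · rw [hG.markCount_eq_zero hω (not_le.1 hc)]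
    simp

end

lemma sum_range_ite_eq {D y₀ : ℕ} {p : ℕ → Prop} [DecidablePred p] {Q : Prop} [Decidable Q]
    (h : ∀ y, p y ↔ Q ∧ y = y₀) (hD : Q → y₀ < D) (w : ℕ → ℝ) :
    ∑ y ∈ Finset.range D, (if p y then w y else 0) = if Q then w y₀ else 0 := by
  simp only [h]
  split_ifs with hQ
  · simp [hQ, hD hQ]
  · simp [hQ]

lemma mem_splitSizes_of_le {I : Finset ℤ} {i j : ℤ} (hi : i ∈ I)
    (h : (0 < j ∧ j ≤ i) ∨ (j < 0 ∧ i ≤ j)) : j ∈ splitSizes I := by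
  have h1 := (insert 0 I).min'_le 0 (Finset.mem_insert_self 0 I)
  have h2 := (insert 0 I).min'_le i (Finset.mem_insert_of_mem hi)
  have h3 := (insert 0 I).le_max' 0 (Finset.mem_insert_self 0 I)
  have h4 := (insert 0 I).le_max' i (Finset.mem_insert_of_mem hi)
  rw [splitSizes, Finset.mem_erase, Finset.mem_Icc]
  omega

/-! ### Moments of the Poisson distribution -/

lemma hasSum_poisson_mul (a : ℝ≥0) :
    HasSum (fun n : ℕ => Real.exp (-a) * a ^ n / n.factorial * (n : ℝ)) a := by
  rw [← hasSum_nat_add_iff' 1]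
  have := (hasSum_one_poissonMeasure a).mul_left (a : ℝ)
  convert! this using 1
  · funext n
    rw [Nat.factorial_succ]
    push_cast
    field_simp
    ring
  · simp

/-- The factorial moment of n(n - 1) is a², by shifting the index by two; adding the mean gives the
second moment. -/
lemma hasSum_poisson_mul_sq (a : ℝ≥0) :
    HasSum (fun n : ℕ => Real.exp (-a) * a ^ n / n.factorial * (n : ℝ) ^ 2)
      ((a : ℝ) ^ 2 + a) := by
  have h2 : HasSum (fun n : ℕ => Real.exp (-a) * a ^ n / n.factorial * ((n : ℝ) * (n - 1)))
      ((a : ℝ) ^ 2) := by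
    rw [← hasSum_nat_add_iff' 2]
    have := (hasSum_one_poissonMeasure a).mul_left ((a : ℝ) ^ 2)
    convert! this using 1
    · funext n
      rw [Nat.factorial_succ, Nat.factorial_succ]
      push_cast
      field_simp
      ring
    · simp [Finset.sum_range_succ]
  convert! h2.add (hasSum_poisson_mul a) using 1
  funext n
  ring

lemma memLp_poissonMeasure (a : ℝ≥0) : MemLp (fun n : ℕ => (n : ℝ)) 2 (poissonMeasure a) := by
  rw [memLp_two_iff_integrable_sq .of_discrete, integrable_poissonMeasure_iff]
  convert! (hasSum_poisson_mul_sq a).summable using 3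
  simp

lemma variance_poissonMeasure (a : ℝ≥0) :
    Var[fun n : ℕ => (n : ℝ); poissonMeasure a] = a := by
  rw [variance_eq_sub (memLp_poissonMeasure a), integral_poissonMeasure]
  simp only [Pi.pow_apply]
  rw [integral_poissonMeasure]
  simp only [smul_eq_mul]
  rw [(hasSum_poisson_mul_sq a).tsum_eq, (hasSum_poisson_mul a).tsum_eq]
  ring

section

variable {C : Type*} [Fintype C] {P : Measure Ω} [IsProbabilityMeasure P]
  {M : C → ℝ≥0 → Ω → ℕ} {r : C → ℝ → ℝ}

lemma HasPoissonIncrements.hasLaw_apply (h : HasPoissonIncrements M r P)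
    (hr : ∀ c, IsRate (r c)) (hM : ∀ c, IsCounting (M c) P) (c : C) (t : ℝ≥0) :
    HasLaw (M c t) (poissonMeasure (cumRate (r c) 0 t).toNNReal) P := by
  refine (h.hasLaw hr (fun c => (hM c).measurable) c (zero_le (a := t))).congr ?_
  filter_upwards [(hM c).path] with ω hω
  rw [hω.1, tsub_zero]

lemma HasPoissonIncrements.memLp_apply (h : HasPoissonIncrements M r P)
    (hr : ∀ c, IsRate (r c)) (hM : ∀ c, IsCounting (M c) P) (c : C) (t : ℝ≥0) :
    MemLp (fun ω => (M c t ω : ℝ)) 2 P := by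
  have hlaw := h.hasLaw_apply hr hM c t
  have := memLp_poissonMeasure (cumRate (r c) 0 t).toNNReal
  rw [← hlaw.map_eq] at this
  exact (memLp_map_measure_iff .of_discrete hlaw.aemeasurable).1 this

lemma HasPoissonIncrements.variance_apply (h : HasPoissonIncrements M r P)
    (hr : ∀ c, IsRate (r c)) (hM : ∀ c, IsCounting (M c) P) (c : C) (t : ℝ≥0) :
    Var[fun ω => (M c t ω : ℝ); P] = cumRate (r c) 0 t := by
  have hlaw := h.hasLaw_apply hr hM c t
  have h1 := variance_poissonMeasure (cumRate (r c) 0 t).toNNReal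
  rw [← hlaw.map_eq, variance_map Measurable.of_discrete.aemeasurable hlaw.aemeasurable,
    Real.coe_toNNReal _ ((hr c).cumRate_nonneg zero_le)] at h1
  exact h1

/-- Independence kills the off-diagonal terms of the bilinear expansion; on the diagonal the Poisson
variance is the cumulative rate. -/
lemma HasPoissonIncrements.covariance_sum (h : HasPoissonIncrements M r P)
    (hr : ∀ c, IsRate (r c)) (hM : ∀ c, IsCounting (M c) P) (t : ℝ≥0) (a b : C → ℝ) :
    cov[fun ω => ∑ c, a c * M c t ω, fun ω => ∑ c, b c * M c t ω; P] =
      ∑ c, a c * b c * cumRate (r c) 0 t := by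
  have hmem := fun c => h.memLp_apply hr hM c t
  rw [covariance_fun_sum_fun_sum (fun c => (hmem c).const_mul (a c))
    (fun c => (hmem c).const_mul (b c))]
  refine Finset.sum_congr rfl fun c _ => ?_
  simp_rw [covariance_const_mul_left, covariance_const_mul_right]
  rw [Fintype.sum_eq_single c]
  · rw [covariance_self (hmem c).aemeasurable, h.variance_apply hr hM c t]
    ring
  · intro c' hc'
    have h1 := (h.iIndepFun hr hM).indepFun hc'.symm
    have hmeas : Measurable (fun x : ℝ≥0 → ℕ => (x t : ℝ)) :=
      (Measurable.of_discrete (f := fun n : ℕ => (n : ℝ))).comp (measurable_pi_apply t)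
    have h2 := (h1.comp hmeas hmeas).covariance_eq_zero (hmem c) (hmem c')
    have h3 : cov[fun ω => (M c t ω : ℝ), fun ω => (M c' t ω : ℝ); P] = 0 := h2
    rw [h3]
    ring

end

/-! ### The two components -/

/-- For a given jump size at most one mark produces the part `j`. This and its three analogues
reduce the sums over colours to the stated rates. -/
lemma sign_mul_eq_iff_of_pos {i j : ℤ} (hj : 0 < j) (y : ℕ) :
    (y ≤ i.natAbs ∧ i.sign * (y : ℤ) = j) ↔ (0 < i ∧ j ≤ i) ∧ y = j.natAbs := by
  rcases lt_trichotomy i 0 with hi | rfl | hi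
  · rw [Int.sign_eq_neg_one_of_neg hi]
    omega
  · simp
    omega
  · rw [Int.sign_eq_one_of_pos hi]
    omega

lemma sign_mul_eq_iff_of_neg {i j : ℤ} (hj : j < 0) (y : ℕ) :
    (y ≤ i.natAbs ∧ i.sign * (y : ℤ) = j) ↔ (i < 0 ∧ i ≤ j) ∧ y = j.natAbs := by
  rcases lt_trichotomy i 0 with hi | rfl | hi
  · rw [Int.sign_eq_neg_one_of_neg hi]
    omega
  · simp
    omega
  · rw [Int.sign_eq_one_of_pos hi]
    omega

lemma sign_mul_abs_sub_eq_iff_of_pos {i j : ℤ} (hj : 0 < j) (y : ℕ) :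
    (y ≤ i.natAbs ∧ i.sign * (|i| - (y : ℤ)) = j) ↔ (0 < i ∧ j ≤ i) ∧ y = (i - j).natAbs := by
  rcases lt_trichotomy i 0 with hi | rfl | hi
  · rw [Int.sign_eq_neg_one_of_neg hi, abs_of_neg hi]
    omega
  · simp
    omega
  · rw [Int.sign_eq_one_of_pos hi, abs_of_pos hi]
    omega

lemma sign_mul_abs_sub_eq_iff_of_neg {i j : ℤ} (hj : j < 0) (y : ℕ) :
    (y ≤ i.natAbs ∧ i.sign * (|i| - (y : ℤ)) = j) ↔
      (i < 0 ∧ i ≤ j) ∧ y = i.natAbs - j.natAbs := by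
  rcases lt_trichotomy i 0 with hi | rfl | hi
  · rw [Int.sign_eq_neg_one_of_neg hi, abs_of_neg hi]
    omega
  · simp
    omega
  · rw [Int.sign_eq_one_of_pos hi, abs_of_pos hi]
    omega

section

variable {I : Finset ℤ} (lam : ℤ → ℝ → ℝ) (q : ℕ → ℤ → ℝ) {D : ℕ}

lemma splitRateFst_eq (hD : ∀ i ∈ I, i.natAbs < D) {j : ℤ} (hj : j ∈ splitSizes I) (u : ℝ) :
    splitRateFst I lam q j u = ∑ i ∈ I, ∑ y ∈ Finset.range D,
      if y ≤ i.natAbs ∧ i.sign * (y : ℤ) = j then lam i u * q y i else 0 := by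
  have hj0 : j ≠ 0 := (Finset.mem_erase.1 hj).1
  unfold splitRateFst
  split_ifs with hpos
  · rw [Finset.sum_filter]
    refine Finset.sum_congr rfl fun i hi => (sum_range_ite_eq
      (fun y => sign_mul_eq_iff_of_pos hpos (i := i) y) (fun _ => ?_)
      (fun y => lam i u * q y i)).symm
    have := hD i hi
    omega
  · rw [Finset.sum_filter]
    refine Finset.sum_congr rfl fun i hi => (sum_range_ite_eq
      (fun y => sign_mul_eq_iff_of_neg (show j < 0 by omega) (i := i) y) (fun _ => ?_)
      (fun y => lam i u * q y i)).symm
    have := hD i hi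
    omega

lemma splitRateSnd_eq (hD : ∀ i ∈ I, i.natAbs < D) {j : ℤ} (hj : j ∈ splitSizes I) (u : ℝ) :
    splitRateSnd I lam q j u = ∑ i ∈ I, ∑ y ∈ Finset.range D,
      if y ≤ i.natAbs ∧ i.sign * (|i| - (y : ℤ)) = j then lam i u * q y i else 0 := by
  have hj0 : j ≠ 0 := (Finset.mem_erase.1 hj).1
  unfold splitRateSnd
  split_ifs with hpos
  · rw [Finset.sum_filter]
    refine Finset.sum_congr rfl fun i hi => (sum_range_ite_eq
      (fun y => sign_mul_abs_sub_eq_iff_of_pos hpos (i := i) y) (fun _ => ?_)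
      (fun y => lam i u * q y i)).symm
    have := hD i hi
    omega
  · rw [Finset.sum_filter]
    refine Finset.sum_congr rfl fun i hi => (sum_range_ite_eq
      (fun y => sign_mul_abs_sub_eq_iff_of_neg (show j < 0 by omega) (i := i) y) (fun _ => ?_)
      (fun y => lam i u * q y i)).symm
    have := hD i hi
    omega

end

lemma sign_mul_mem_splitSizes {I : Finset ℤ} {i : ℤ} (hi : i ∈ I) {y : ℤ} (hy0 : 0 ≤ y)
    (hy : y ≤ |i|) : i.sign * y ∈ splitSizes I ∨ i.sign * y = 0 := by
  rcases hy0.eq_or_lt with rfl | hpos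
  · simp
  left
  rcases lt_trichotomy i 0 with h | rfl | h
  · rw [Int.sign_eq_neg_one_of_neg h]
    rw [abs_of_neg h] at hy
    exact mem_splitSizes_of_le hi (by omega)
  · simp at hy
    omega
  · rw [Int.sign_eq_one_of_pos h]
    rw [abs_of_pos h] at hy
    exact mem_splitSizes_of_le hi (by omega)

section

variable {P : Measure Ω} [IsProbabilityMeasure P] {I : Finset ℤ} {lam : ℤ → ℝ → ℝ}
  {q : ℕ → ℤ → ℝ} {S : ℝ≥0 → Ω → ℤ} {Y : ℕ → Ω → ℕ} {N : ℤ → ℝ≥0 → Ω → ℕ} {G : Set Ω}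

lemma covariance_congr_of_ae {μ : Measure Ω} {X X' Z Z' : Ω → ℝ} (hX : X =ᵐ[μ] X')
    (hZ : Z =ᵐ[μ] Z') : cov[X, Z; μ] = cov[X', Z'; μ] := by
  unfold covariance
  rw [integral_congr_ae hX, integral_congr_ae hZ]
  refine integral_congr_ae ?_
  filter_upwards [hX, hZ] with ω h1 h2
  rw [h1, h2]

/-- Second moments of sums of functions of the marked jumps. -/
lemma memLp_and_covariance_sum_marks (hS : ∀ t, Measurable (S t))
    (hlam : ∀ i ∈ I, IsRate (lam i)) (hq : IsSplitRule I q) (hY : IsSplitting q S Y P)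
    (hN : ∀ i ∈ I, ∀ t, Measurable (N i t)) (hG : IsGoodEvent G I N S Y P)
    (hP : HasPoissonIncrements (fun i : I => N i) (fun i : I => lam i) P) (t : ℝ≥0)
    (v w : ℤ → ℕ → ℤ) {U W : Ω → ℤ}
    (hU : ∀ ω, U ω =
      ∑ k ∈ Finset.Icc 1 (jumpCount (path S ω) t), v (jumpSize (path S ω) k) (Y k ω))
    (hW : ∀ ω, W ω =
      ∑ k ∈ Finset.Icc 1 (jumpCount (path S ω) t), w (jumpSize (path S ω) k) (Y k ω)) :
    MemLp (fun ω => (U ω : ℝ)) 2 P ∧ MemLp (fun ω => (W ω : ℝ)) 2 P ∧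
    cov[fun ω => (U ω : ℝ), fun ω => (W ω : ℝ); P] =
      ∑ i ∈ I, cumRate (lam i) 0 t * splitMean q i (fun y => (v i y : ℝ) * w i y) := by
  obtain ⟨D, hD⟩ : ∃ D, ∀ i ∈ I, i.natAbs < D :=
    ⟨I.sup Int.natAbs + 1, fun i hi => Nat.lt_succ_of_le (Finset.le_sup (f := Int.natAbs) hi)⟩
  have hM : ∀ c : I × Fin D, IsCounting (markCount G I N S Y c.1 c.2) P := fun c =>
    hG.isCounting_markCount hS hY.measurable hN c.1 c.2
  have hMr : ∀ c : I × Fin D, IsRate (fun u => lam c.1 u * q c.2 c.1) := fun c =>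
    (hlam c.1 c.1.2).mul_const (hq.nonneg c.1 c.1.2 _)
  have hMP := hasPoissonIncrements_markCount hS hq hY hN hG hP hD
  have hae : ∀ (v : ℤ → ℕ → ℤ) {U : Ω → ℤ}, (∀ ω, U ω =
      ∑ k ∈ Finset.Icc 1 (jumpCount (path S ω) t), v (jumpSize (path S ω) k) (Y k ω)) →
      (fun ω => (U ω : ℝ)) =ᵐ[P] fun ω =>
        ∑ c : I × Fin D, (v c.1 c.2 : ℝ) * markCount G I N S Y c.1 c.2 t ω := by
    intro v U hU
    filter_upwards [hG.ae_mem] with ω hω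
    rw [hU, hG.sum_marks_eq hD v hω]
    push_cast
    rfl
  have hmem : ∀ v : ℤ → ℕ → ℤ, MemLp (fun ω =>
      ∑ c : I × Fin D, (v c.1 c.2 : ℝ) * markCount G I N S Y c.1 c.2 t ω) 2 P := fun v =>
    memLp_finsetSum _ fun c _ => (hMP.memLp_apply hMr hM c t).const_mul _
  refine ⟨(hmem v).ae_eq (hae v hU).symm, (hmem w).ae_eq (hae w hW).symm, ?_⟩
  rw [covariance_congr_of_ae (hae v hU) (hae w hW),
    hMP.covariance_sum hMr hM t (fun c => (v c.1 c.2 : ℝ)) (fun c => (w c.1 c.2 : ℝ)),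
    Fintype.sum_prod_type, ← Finset.sum_coe_sort I]
  refine Finset.sum_congr rfl fun i _ => ?_
  rw [splitMean, ← hq.sum_range_eq i.2 (hD i i.2) (fun y => (v i y : ℝ) * w i y),
    Finset.sum_range, Finset.mul_sum]
  refine Finset.sum_congr rfl fun y _ => ?_
  rw [cumRate_mul_const]
  ring

end

lemma splitMean_sign_mul {q : ℕ → ℤ → ℝ} {i : ℤ} (hi : i ≠ 0) :
    splitMean q i (fun y => ((i.sign * (y : ℤ) : ℤ) : ℝ) * ((i.sign * (|i| - (y : ℤ)) : ℤ) : ℝ)) =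
      splitMean q i (fun y => (y : ℝ) * (|(i : ℝ)| - (y : ℝ))) := by
  refine Finset.sum_congr rfl fun y _ => ?_
  have hs : ((i.sign : ℤ) : ℝ) * (i.sign : ℝ) = 1 := by
    rcases lt_or_gt_of_ne hi with h | h
    · rw [Int.sign_eq_neg_one_of_neg h]; simp
    · rw [Int.sign_eq_one_of_pos h]; simp
  push_cast
  congr 1
  linear_combination ((y : ℝ) * (|(i : ℝ)| - (y : ℝ))) * hs

lemma splitMean_mul_abs_sub_nonneg {I : Finset ℤ} {q : ℕ → ℤ → ℝ} (hq : IsSplitRule I q) {i : ℤ}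
    (hi : i ∈ I) : 0 ≤ splitMean q i (fun y => (y : ℝ) * (|(i : ℝ)| - (y : ℝ))) := by
  refine Finset.sum_nonneg fun y hy => mul_nonneg (mul_nonneg (Nat.cast_nonneg y) ?_)
    (hq.nonneg i hi y)
  have h1 : (y : ℝ) ≤ (i.natAbs : ℝ) := by
    exact_mod_cast Nat.lt_succ_iff.1 (Finset.mem_range.1 hy)
  rw [Nat.cast_natAbs, Int.cast_abs] at h1
  linarith

lemma splitMean_mul_abs_sub_pos {I : Finset ℤ} {q : ℕ → ℤ → ℝ} (hq : IsSplitRule I q) {i : ℤ}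
    (hi : i ∈ I) {j : ℕ} (hj0 : 0 < j) (hji : j < i.natAbs) (hqj : 0 < q j i) :
    0 < splitMean q i (fun y => (y : ℝ) * (|(i : ℝ)| - (y : ℝ))) := by
  have habs : |(i : ℝ)| = (i.natAbs : ℝ) := by rw [Nat.cast_natAbs, Int.cast_abs]
  rw [splitMean, habs]
  refine Finset.sum_pos' (fun y hy => ?_) ⟨j, Finset.mem_range.2 (by omega), ?_⟩
  · have h1 : (y : ℝ) ≤ (i.natAbs : ℝ) := by
      exact_mod_cast Nat.lt_succ_iff.1 (Finset.mem_range.1 hy)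
    exact mul_nonneg (mul_nonneg (Nat.cast_nonneg y) (by linarith)) (hq.nonneg i hi y)
  · have h1 : (j : ℝ) < (i.natAbs : ℝ) := by exact_mod_cast hji
    have h2 : (0 : ℝ) < j := by exact_mod_cast hj0
    exact mul_pos (mul_pos h2 (by linarith)) hqj

end Skellam

end

/-! ### The splitting theorem for generalized Skellam processes -/

theorem mainTheorem5 {Ω : Type*} [MeasurableSpace Ω] (P : Measure Ω) [IsProbabilityMeasure P]
    (I : Finset ℤ) (lam : ℤ → ℝ → ℝ) (q : ℕ → ℤ → ℝ)
    (S : ℝ≥0 → Ω → ℤ) (Y : ℕ → Ω → ℕ)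
    (hSm : ∀ t, Measurable (S t))
    (hS : Skellam.IsNHGSP I lam S P)
    (hq : Skellam.IsSplitRule I q)
    (hY : Skellam.IsSplitting q S Y P) :
    -- the two components are generalized Skellam processes with the stated rates
    Skellam.IsNHGSP (Skellam.splitSizes I) (Skellam.splitRateFst I lam q)
      (Skellam.splitFst S Y) P ∧
    Skellam.IsNHGSP (Skellam.splitSizes I) (Skellam.splitRateSnd I lam q)
      (Skellam.splitSnd S Y) P ∧
    -- they are dependent as soon as some jump is properly split with positive probability,
    -- already at each fixed time by which this can have happened
    (∀ t : ℝ≥0, (∃ i ∈ I, 0 < Skellam.cumRate (lam i) 0 t ∧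
        ∃ j : ℕ, 0 < j ∧ j < i.natAbs ∧ 0 < q j i) →
      ¬ IndepFun (fun ω t => Skellam.splitFst S Y t ω) (fun ω t => Skellam.splitSnd S Y t ω) P ∧
      ¬ IndepFun (Skellam.splitFst S Y t) (Skellam.splitSnd S Y t) P) ∧
    -- covariance
    (∀ t : ℝ≥0,
      MemLp (fun ω => (Skellam.splitFst S Y t ω : ℝ)) 2 P ∧
      MemLp (fun ω => (Skellam.splitSnd S Y t ω : ℝ)) 2 P ∧
      cov[fun ω => (Skellam.splitFst S Y t ω : ℝ), fun ω => (Skellam.splitSnd S Y t ω : ℝ); P] =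
        ∑ i ∈ I, Skellam.cumRate (lam i) 0 t *
          Skellam.splitMean q i (fun y => (y : ℝ) * (|(i : ℝ)| - (y : ℝ)))) := by
  obtain ⟨h0, hlam, N, hN, hind, hrepr⟩ := hS
  have hpath := Skellam.ae_isSkellamPath h0 hlam hN hind hrepr
  obtain ⟨G, hG⟩ := Skellam.exists_isGoodEvent hSm hq hY hpath
  have hNm : ∀ i ∈ I, ∀ t, Measurable (N i t) := fun i hi => (hN i hi).measurable
  have hP := Skellam.hasPoissonIncrements_of_iIndepFun (N := fun i : I => N i)
    (r := fun i : I => lam i) (fun i => hlam i i.2) (fun i => hN i i.2) hind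
  obtain ⟨D, hD⟩ : ∃ D, ∀ i ∈ I, i.natAbs < D :=
    ⟨I.sup Int.natAbs + 1, fun i hi => Nat.lt_succ_of_le (Finset.le_sup (f := Int.natAbs) hi)⟩
  have hJ0 : (0 : ℤ) ∉ Skellam.splitSizes I := Finset.notMem_erase _ _
  have hmoments : ∀ t : ℝ≥0,
      MemLp (fun ω => (Skellam.splitFst S Y t ω : ℝ)) 2 P ∧
      MemLp (fun ω => (Skellam.splitSnd S Y t ω : ℝ)) 2 P ∧
      cov[fun ω => (Skellam.splitFst S Y t ω : ℝ), fun ω => (Skellam.splitSnd S Y t ω : ℝ); P] =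
        ∑ i ∈ I, Skellam.cumRate (lam i) 0 t *
          Skellam.splitMean q i (fun y => (y : ℝ) * (|(i : ℝ)| - (y : ℝ))) := by
    intro t
    obtain ⟨h1, h2, h3⟩ := Skellam.memLp_and_covariance_sum_marks hSm hlam hq hY hNm hG hP t
      (fun i y => i.sign * (y : ℤ)) (fun i y => i.sign * (|i| - (y : ℤ)))
      (U := Skellam.splitFst S Y t) (W := Skellam.splitSnd S Y t) (fun _ => rfl) (fun _ => rfl)
    refine ⟨h1, h2, h3.trans (Finset.sum_congr rfl fun i hi => ?_)⟩
    rw [Skellam.splitMean_sign_mul (fun h => h0 (h ▸ hi))]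
  refine ⟨?_, ?_, fun t ⟨i, hi, hΛ, j, hj0, hji, hqj⟩ => ?_, hmoments⟩
  · exact Skellam.isNHGSP_sum_marks hSm hlam hq hY hNm hG hP hD (fun i y => i.sign * (y : ℤ)) hJ0
      (fun i hi y hy => Skellam.sign_mul_mem_splitSizes hi (by positivity)
        (by rw [Int.abs_eq_natAbs]; omega))
      (fun j hj u => Skellam.splitRateFst_eq lam q hD hj u) (fun _ _ => rfl)
  · exact Skellam.isNHGSP_sum_marks hSm hlam hq hY hNm hG hP hD
      (fun i y => i.sign * (|i| - (y : ℤ))) hJ0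
      (fun i hi y hy => Skellam.sign_mul_mem_splitSizes hi
        (by rw [Int.abs_eq_natAbs]; omega) (by omega))
      (fun j hj u => Skellam.splitRateSnd_eq lam q hD hj u) (fun _ _ => rfl)
  · have hnot : ¬ IndepFun (Skellam.splitFst S Y t) (Skellam.splitSnd S Y t) P := by
      intro hcon
      obtain ⟨h1, h2, h3⟩ := hmoments t
      have hcast : Measurable (fun n : ℤ => (n : ℝ)) := .of_discrete
      -- Square integrability lets independence force zero covariance, whereas the properly split
      -- jump size contributes a strictly positive term.
      have h4 := (hcon.comp hcast hcast).covariance_eq_zero h1 h2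
      have h5 : 0 < ∑ i ∈ I, Skellam.cumRate (lam i) 0 t *
          Skellam.splitMean q i (fun y => (y : ℝ) * (|(i : ℝ)| - (y : ℝ))) :=
        Finset.sum_pos' (fun i hi => mul_nonneg ((hlam i hi).cumRate_nonneg zero_le)
          (Skellam.splitMean_mul_abs_sub_nonneg hq hi))
          ⟨i, hi, mul_pos hΛ (Skellam.splitMean_mul_abs_sub_pos hq hi hj0 hji hqj)⟩
      rw [← h3] at h5
      exact h5.ne' h4
    refine ⟨fun hcon => hnot ?_, hnot⟩
    -- Independent processes would have independent values at time `t`.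
    have heval : Measurable (fun x : ℝ≥0 → ℤ => x t) := measurable_pi_apply t
    exact hcon.comp heval heval
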